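/- Let $X^{(s)}$ denote the set of $s$-element subsets of a set $X$. In an $r$-uniform hypergraph $\mathcal H$ with vertex set $X$, a set $A\subset X$ is covered if there is a vertex $u\notin A$ such that $B\cup\{u\}\in\mathcal H$ for every $B\in A^{(r-1)}$. Let $f(n,k,r)$ be the minimum number of edges in an $r$-uniform hypergraph with vertex set $[n]=\{1,\dots,n\}$ in which every $k$-set of vertices is covered. Let $D(m,r)$ be the minimum number of edges in an $r$-uniform hypergraph with vertex set $[m]$ such that every $(r-1)$-subset of $[m]$ is contained in some edge. For $n>k\ge r-1\ge 0$ let $$g(n,k,r)=\binom nr-\binom{n-k+r-1}{r}+D(n-k+r-1,r),$$ and let $\mathcal G(n,k,r)$ be the family of $r$-uniform hypergraphs on $[n]$ whose edges are all $r$-sets that meet $\{1,\dots,k-r+1\}$ together with a collection of exactly $D(n-k+r-1,r)$ $r$-subsets of $\{k-r+2,\dots,n\}$ such that every $(r-1)$-subset of $\{k-r+2,\dots,n\}$ is contained in at least one member of the collection. Theorem. For all integers $k,r$ with $r\ge 1$ and $k\ge r-1$ there is an integer $n_0(k,r)$ such that for all $n>n_0(k,r)$ $$f(n,k,r)=g(n,k,r).$$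 Furthermore, if $\mathcal H$ is an $r$-uniform hypergraph with $n$ vertices and $f(n,k,r)$ edges in which every $k$-set of vertices is covered, then $\mathcal H$ is isomorphic to some element of $\mathcal G(n,k,r)$. -/

import Mathlib

namespace CoveredSets

/-- In the `r`-uniform hypergraph with edge set `H`, the vertex `u` covers the vertex set `A`:
`u ∉ A` and `B ∪ {u}` is an edge for every `(r - 1)`-subset `B` of `A`. -/
def Covers {V : Type*} [DecidableEq V] (r : ℕ) (H : Finset (Finset V)) (u : V) (A : Finset V) :
    Prop :=
  u ∉ A ∧ ∀ B ∈ A.powersetCard (r - 1), insert u B ∈ H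

/-- `H` is the edge set of an `r`-uniform hypergraph on `V` in which every `k`-set of vertices is
covered by some vertex. -/
def EveryCovered {V : Type*} [DecidableEq V] (k r : ℕ) (H : Finset (Finset V)) : Prop :=
  (∀ e ∈ H, e.card = r) ∧ ∀ A : Finset V, A.card = k → ∃ u : V, Covers r H u A

/-- `f n k r`: the minimum number of edges of an `r`-uniform hypergraph on an `n`-set of vertices
in which every `k`-set is covered. -/
noncomputable def f (n k r : ℕ) : ℕ :=
  sInf {m : ℕ | ∃ H : Finset (Finset (Fin n)), EveryCovered k r H ∧ H.card = m}

/-- `D n r`: the minimum number of edges of an `r`-uniform hypergraph on an `n`-set of vertices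
such that every `(r - 1)`-set of vertices is contained in an edge. -/
noncomputable def D (n r : ℕ) : ℕ :=
  sInf {m : ℕ | ∃ H : Finset (Finset (Fin n)), (∀ e ∈ H, e.card = r) ∧
    (∀ B : Finset (Fin n), B.card = r - 1 → ∃ e ∈ H, B ⊆ e) ∧ H.card = m}

/-- `g n k r`, where `n - (k + 1 - r)` is `n - k + r - 1` (used for `r ≤ k + 1` and `k < n`). -/
noncomputable def g (n k r : ℕ) : ℕ :=
  n.choose r - (n - (k + 1 - r)).choose r + D (n - (k + 1 - r)) r

/-- The first `k - r + 1` vertices. -/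
def core (n k r : ℕ) : Finset (Fin n) :=
  Finset.univ.filter fun v => v.val < k + 1 - r

/-- The family of `r`-uniform hypergraphs consisting of all `r`-sets that meet the first
`k - r + 1` vertices, together with `D (n - k + r - 1) r` many `r`-sets `C` of the remaining
vertices such that every `(r - 1)`-set of the remaining vertices is contained in a member of `C`. -/
def family (n k r : ℕ) : Set (Finset (Finset (Fin n))) :=
  {H | ∃ C : Finset (Finset (Fin n)),
    (∀ e ∈ C, e.card = r ∧ Disjoint e (core n k r)) ∧
    (∀ B : Finset (Fin n), B.card = r - 1 → Disjoint B (core n k r) → ∃ e ∈ C, B ⊆ e) ∧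
    C.card = D (n - (k + 1 - r)) r ∧
    H = (Finset.univ.powersetCard r).filter (fun e => ¬ Disjoint e (core n k r)) ∪ C}

/-- Two hypergraphs are isomorphic: a bijection of the vertex sets carries the one edge set onto
the other. -/
def Isomorphic {V W : Type*} [DecidableEq W] (H : Finset (Finset V)) (K : Finset (Finset W)) :
    Prop :=
  ∃ σ : V ≃ W, H.image (fun e => e.map σ.toEmbedding) = K

/-- For `k < n` the minimum in the definition of `f` is over a nonempty set, so it is attained. -/
theorem f_isLeast {n k r : ℕ} (hr : 1 ≤ r) (hn : k < n) :
    IsLeast {m : ℕ | ∃ H : Finset (Finset (Fin n)), EveryCovered k r H ∧ H.card = m}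
      (f n k r) := by
  refine ⟨Nat.sInf_mem ⟨_, Finset.univ.powersetCard r, ⟨?_, ?_⟩, rfl⟩, fun m hm => Nat.sInf_le hm⟩
  · intro e he
    exact (Finset.mem_powersetCard.1 he).2
  · intro A hA
    obtain ⟨u, hu⟩ : ∃ u, u ∉ A := by
      by_contra! h
      have := Finset.card_le_card (fun x _ => h x : (Finset.univ : Finset (Fin n)) ⊆ A)
      simp at this
      omega
    refine ⟨u, hu, fun B hB => ?_⟩
    rw [Finset.mem_powersetCard] at hB ⊢
    refine ⟨Finset.subset_univ _, ?_⟩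
    rw [Finset.card_insert_of_notMem fun h => hu (hB.1 h), hB.2]
    omega

/-- For `1 ≤ r ≤ n` the minimum in the definition of `D` is over a nonempty set, so it is
attained. -/
theorem D_isLeast {n r : ℕ} (hr : 1 ≤ r) (hn : r ≤ n) :
    IsLeast {m : ℕ | ∃ H : Finset (Finset (Fin n)), (∀ e ∈ H, e.card = r) ∧
      (∀ B : Finset (Fin n), B.card = r - 1 → ∃ e ∈ H, B ⊆ e) ∧ H.card = m} (D n r) := by
  refine ⟨Nat.sInf_mem ⟨_, Finset.univ.powersetCard r, ?_, ?_, rfl⟩, fun m hm => Nat.sInf_le hm⟩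
  · intro e he
    exact (Finset.mem_powersetCard.1 he).2
  · intro B hB
    obtain ⟨e, hBe, -, he⟩ := Finset.exists_subsuperset_card_eq (Finset.subset_univ B)
      (show B.card ≤ r by omega) (by simpa using hn)
    exact ⟨e, Finset.mem_powersetCard.2 ⟨Finset.subset_univ _, he⟩, hBe⟩

end CoveredSets

/-!
Write `r = j + 1` and `k = j + t`, so that the core has `t` vertices. If `H` contains every edge
meeting some `t`-set `T`, then its remaining edges form a covering design on the complement of `T`,
because a `j`-set `B` outside `T` is completed by the vertex covering `B ∪ T`
(`EveryCovered.conclusion`). So the point is to find such a `T` in every hypergraph `H` with at most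
`g` edges. For `r = 1` this is immediate; for `r ≥ 2` there are two steps.

*Stability* (`exists_almost_core`). Covering designs with about `(n choose j) / r` edges exist
(`mul_D_le`), so `H` has at most about `(t + 1 / r) (n choose j)` edges. Let `U` be the bounded set
of vertices of large degree. By the Kruskal–Katona theorem the other vertices cover few `r`-sets
(`card_coveredOutside_le`). An `r`-set is covered by at least `t` vertices, so almost all `j`-sets
have at least `t` completions in `U`, and a `j`-set with at most `t` of them has one more outside
`U`. Comparison with the number of edges shows that almost all `j`-sets have exactly `t`
completions in `U` (`EveryCovered.card_excessive_le`). All the `j`-subsets of a typical `r`-set then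
have the same completions in `U`, and a second use of Kruskal–Katona shows that almost all `j`-sets
share the same `T` (`exists_dominant_colour`). Hence all but a small proportion of the edges meeting
`T` are present.

*Exactness* (`exists_core`). If an edge meeting `T` is missing, then every `j`-set outside `T` that
contains its trace is bad: together with any further vertex it has to be covered by a vertex outside
`T`. Around each set in the shadow of the bad sets, linearly many edges outside `T` can be saved
without destroying the covering property (`exists_saving`). The number of missing edges is at most a
constant multiple of the number of bad sets, which by Kruskal–Katona is of smaller order than `n`
times the size of their shadow. So the saving exceeds the number of missing edges, contradicting
`#H ≤ g`.
-/

namespace CoveredSets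
open Finset
open scoped FinsetFamily

/-! ### Binomial estimates and the Kruskal–Katona theorem -/

theorem choose_succ_le_choose_add_mul_choose {n x : ℕ} (hx : x ≤ n) (i : ℕ) :
    n.choose (i + 1) ≤ x.choose (i + 1) + (n - x) * n.choose i := by
  obtain ⟨d, rfl⟩ := Nat.exists_eq_add_of_le hx
  rw [Nat.add_sub_cancel_left]
  induction d with
  | zero => simp
  | succ d ih =>
    have h1 : (x + d).choose i ≤ (x + (d + 1)).choose i := Nat.choose_le_choose _ (by omega)
    have h2 : d * (x + d).choose i ≤ d * (x + (d + 1)).choose i := Nat.mul_le_mul_left _ h1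
    have h3 : (x + (d + 1)).choose (i + 1) = (x + d).choose i + (x + d).choose (i + 1) :=
      Nat.choose_succ_succ _ _
    have := ih (by omega)
    rw [h3, add_mul, one_mul]
    omega

theorem choose_succ_le_choose_add {n x : ℕ} (hx : x ≤ n) (i : ℕ) :
    n.choose (i + 1) ≤ x.choose (i + 1) + (n - x) * n ^ i :=
  (choose_succ_le_choose_add_mul_choose hx i).trans
    (Nat.add_le_add_left (Nat.mul_le_mul_left _ (Nat.choose_le_pow _ _)) _)

/-- A lower bound for binomial coefficients of the right order of magnitude. -/
theorem exists_pos_mul_pow_le_choose (j : ℕ) :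
    ∃ c : ℝ, 0 < c ∧ ∀ (n : ℕ) (y : ℝ), 0 ≤ y → y + j ≤ n + 1 → c * y ^ j ≤ n.choose j := by
  refine ⟨1 / j.factorial, by positivity, fun n y hy hyn => ?_⟩
  have h1 : y ^ j ≤ ((n + 1 - j : ℕ) : ℝ) ^ j := by
    have : (n : ℝ) + 1 - j ≤ ((n + 1 - j : ℕ) : ℝ) := by
      have := le_tsub_add (a := j) (b := n + 1)
      have : ((n + 1 : ℕ) : ℝ) ≤ ((n + 1 - j + j : ℕ) : ℝ) := by exact_mod_cast this
      push_cast at this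
      linarith
    gcongr
    linarith
  calc 1 / (j.factorial : ℝ) * y ^ j ≤ 1 / (j.factorial : ℝ) * ((n + 1 - j : ℕ) : ℝ) ^ j := by
        gcongr
    _ = ((n + 1 - j : ℕ) : ℝ) ^ j / j.factorial := by ring
    _ ≤ n.choose j := by
      have := Nat.pow_le_choose (α := ℝ) j n
      simpa using this

/-- The Lovász form of the Kruskal–Katona theorem, with the family bounded in terms of its
shadow and of an integer `x` whose size is controlled by the shadow. -/
theorem exists_choose_le_card_shadow {n j : ℕ} {𝒜 : Finset (Finset (Fin n))}
    (h𝒜 : (𝒜 : Set (Finset (Fin n))).Sized (j + 1)) (hne : 𝒜.Nonempty) :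
    ∃ x ≤ n, x.choose j ≤ #(∂ 𝒜) ∧ (j + 1) * #𝒜 ≤ (x + 1) * #(∂ 𝒜) := by
  have hcard : #𝒜 ≤ n.choose (j + 1) := by simpa using h𝒜.card_le
  have hj : (j + 1).choose (j + 1) ≤ #𝒜 := by simpa using hne.card_pos
  have hjn : j + 1 ≤ n := by
    by_contra h
    rw [Nat.choose_eq_zero_of_lt (by omega)] at hcard
    have := hne.card_pos
    omega
  set x := Nat.findGreatest (fun x => x.choose (j + 1) ≤ #𝒜) n
  have hxj : j + 1 ≤ x := Nat.le_findGreatest hjn hj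
  have hxn : x ≤ n := Nat.findGreatest_le n
  have hx1 : x.choose (j + 1) ≤ #𝒜 :=
    Nat.findGreatest_spec (P := fun x => x.choose (j + 1) ≤ #𝒜) hjn hj
  have hx2 : #𝒜 ≤ (x + 1).choose (j + 1) := by
    rcases hxn.eq_or_lt with h | h
    · exact hcard.trans (Nat.choose_le_choose _ (by omega))
    · have := Nat.findGreatest_is_greatest (P := fun x => x.choose (j + 1) ≤ #𝒜)
        (Nat.lt_succ_self x) h
      simp only [not_le] at this
      exact this.le
  have hkk : x.choose j ≤ #(∂ 𝒜) := by
    simpa using kruskal_katona_lovasz_form (i := 1) (by omega) hxj hxn h𝒜 hx1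
  refine ⟨x, hxn, hkk, ?_⟩
  calc (j + 1) * #𝒜 ≤ (j + 1) * (x + 1).choose (j + 1) := Nat.mul_le_mul_left _ hx2
    _ = (x + 1) * x.choose j := by rw [mul_comm, Nat.add_one_mul_choose_eq]
    _ ≤ _ := Nat.mul_le_mul_left _ hkk

/-- A family whose shadow is sparse has size `o(n)` times the size of its shadow. -/
theorem exists_card_le_mul_card_shadow (j : ℕ) {ε : ℝ} (hε : 0 < ε) :
    ∃ δ : ℝ, 0 < δ ∧ ∃ n₀ : ℕ, ∀ n ≥ n₀, ∀ 𝒜 : Finset (Finset (Fin n)),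
      (𝒜 : Set (Finset (Fin n))).Sized (j + 1) → (#(∂ 𝒜) : ℝ) ≤ δ * n ^ j →
      (#𝒜 : ℝ) ≤ ε * n * #(∂ 𝒜) := by
  obtain ⟨c, hc, hcn⟩ := exists_pos_mul_pow_le_choose j
  refine ⟨c * (ε / 2) ^ j / 2, by positivity, ⌈2 * j / ε⌉₊ + 1, fun n hn 𝒜 h𝒜 hs => ?_⟩
  have hn1 : (2 * j / ε : ℝ) + 1 ≤ n :=
    (add_le_add_left (Nat.le_ceil _) 1).trans (by exact_mod_cast hn)
  have hn0 : (0 : ℝ) < n := by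
    have : (0 : ℝ) ≤ 2 * j / ε := by positivity
    linarith
  have hjn : (j : ℝ) ≤ ε / 2 * n := by
    have : 2 * j / ε ≤ (n : ℝ) := by linarith
    rw [div_le_iff₀ hε] at this
    linarith
  rcases 𝒜.eq_empty_or_nonempty with rfl | hne
  · simp
  obtain ⟨x, -, hx1, hx2⟩ := exists_choose_le_card_shadow h𝒜 hne
  have hx2' : ((j : ℝ) + 1) * #𝒜 ≤ (x + 1) * #(∂ 𝒜) := by exact_mod_cast hx2
  have hx1' : (x.choose j : ℝ) ≤ #(∂ 𝒜) := by exact_mod_cast hx1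
  by_cases hx : (x : ℝ) + 1 ≤ ε * n
  · have h1 : (#𝒜 : ℝ) ≤ (j + 1) * #𝒜 :=
      le_mul_of_one_le_left (by positivity) (by linarith [Nat.cast_nonneg (α := ℝ) j])
    have h2 : ((x : ℝ) + 1) * #(∂ 𝒜) ≤ ε * n * #(∂ 𝒜) := by gcongr
    linarith
  · exfalso
    have h3 := hcn x (ε / 2 * n) (by positivity) (by linarith)
    have h4 : 0 < c * (ε / 2 * n) ^ j := by positivity
    have h5 : c * (ε / 2) ^ j / 2 * n ^ j = c * (ε / 2 * n) ^ j / 2 := by ring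
    linarith

/-- Suppose that almost all `(i + 2)`-sets are monochromatic for a colouring `S` of the
`(i + 1)`-sets. Then almost all `(i + 1)`-sets have the same colour: by Kruskal–Katona the colour
classes contain too few monochromatic `(i + 2)`-sets unless one class is almost everything. -/
theorem exists_dominant_colour (i : ℕ) {δ : ℝ} (hδ : 0 < δ) (hδ1 : δ ≤ 1) :
    ∃ ε : ℝ, 0 < ε ∧ ∃ n₀ : ℕ, ∀ n ≥ n₀, ∀ (S : Finset (Fin n) → Finset (Fin n))
      (F : Finset (Finset (Fin n))), (F : Set (Finset (Fin n))).Sized (i + 2) →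
      (∀ A ∈ F, ∀ B ∈ A.powersetCard (i + 1), ∀ B' ∈ A.powersetCard (i + 1), S B = S B') →
      (n.choose (i + 2) : ℝ) ≤ #F + ε * n ^ (i + 2) →
      ∃ A ∈ F, ∃ B ∈ A.powersetCard (i + 1),
        (#{B' ∈ univ.powersetCard (i + 1) | S B' ≠ S B} : ℝ) ≤ δ * n ^ (i + 1) := by
  obtain ⟨c, hc, hcn⟩ := exists_pos_mul_pow_le_choose (i + 1)
  refine ⟨δ * c * (1 / 2) ^ (i + 1) / (4 * (i + 2)), by positivity,
    ⌈2 * (i + 2) / δ⌉₊ + 2 * (i + 1), fun n hn S F hF hS hcard => ?_⟩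
  have hn1 : (2 * (i + 2) / δ : ℝ) + 2 * (i + 1) ≤ n :=
    (add_le_add_left (Nat.le_ceil _) _).trans (by exact_mod_cast hn)
  have hpos : (0 : ℝ) ≤ 2 * (i + 2) / δ := by positivity
  have hn0 : (0 : ℝ) < n := by linarith [Nat.cast_nonneg (α := ℝ) i]
  have hin : (i : ℝ) + 2 ≤ δ * n / 2 := by
    have : 2 * (i + 2) / δ ≤ (n : ℝ) := by linarith [Nat.cast_nonneg (α := ℝ) i]
    rw [div_le_iff₀ hδ] at this
    linarith
  by_contra! hcon
  have hB : ∀ A ∈ F, ∃ B, B ∈ A.powersetCard (i + 1) := fun A hA =>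
    powersetCard_nonempty.2 (by rw [hF hA]; omega)
  choose! β hβ using hB
  set col : Finset (Fin n) → Finset (Fin n) := fun A => S (β A)
  have hclass : ∀ T ∈ F.image col, ((i : ℝ) + 2) * #{A ∈ F | col A = T} ≤
      ((1 - δ) * n + 1) * #{B ∈ univ.powersetCard (i + 1) | S B = T} := by
    intro T hT
    obtain ⟨A₀, hA₀, rfl⟩ := mem_image.1 hT
    have hsz : (({A ∈ F | col A = col A₀} : Finset (Finset (Fin n))) :
        Set (Finset (Fin n))).Sized (i + 1 + 1) :=
      fun A hA => hF (mem_filter.1 hA).1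
    obtain ⟨x, hxn, hx1, hx2⟩ := exists_choose_le_card_shadow hsz ⟨A₀, mem_filter.2 ⟨hA₀, rfl⟩⟩
    have hsub : ∂ ({A ∈ F | col A = col A₀} : Finset (Finset (Fin n))) ⊆
        ({B ∈ univ.powersetCard (i + 1) | S B = col A₀} : Finset (Finset (Fin n))) := by
      intro B hB
      obtain ⟨A, hA, a, ha, rfl⟩ := mem_shadow_iff.1 hB
      obtain ⟨hAF, hAc⟩ := mem_filter.1 hA
      have hc : #(A.erase a) = i + 1 := by rw [card_erase_of_mem ha, hF hAF]; rfl
      simp only [mem_filter, mem_powersetCard, subset_univ, true_and]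
      refine ⟨hc, ?_⟩
      rw [← hAc]
      exact hS A hAF _ (mem_powersetCard.2 ⟨erase_subset _ _, hc⟩) _ (hβ A hAF)
    have hle := card_le_card hsub
    have hbad := hcon A₀ hA₀ (β A₀) (hβ A₀ hA₀)
    have hsplit := card_filter_add_card_filter_not (s := (univ : Finset (Fin n)).powersetCard (i + 1))
      (fun B => S B = col A₀)
    rw [card_powersetCard, card_univ, Fintype.card_fin] at hsplit
    have hsplit' : (#{B ∈ (univ : Finset (Fin n)).powersetCard (i + 1) | S B = col A₀} : ℝ) +
      #{B ∈ (univ : Finset (Fin n)).powersetCard (i + 1) | S B ≠ col A₀} = n.choose (i + 1) := by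
      exact_mod_cast hsplit
    have hch : (n.choose (i + 1) : ℝ) ≤ x.choose (i + 1) + (n - x) * n ^ i := by
      have := choose_succ_le_choose_add hxn i
      rw [← Nat.cast_sub hxn]
      exact_mod_cast this
    have hx1' : (x.choose (i + 1) : ℝ) ≤
        #{B ∈ univ.powersetCard (i + 1) | S B = col A₀} := by exact_mod_cast hx1.trans hle
    have hx : (x : ℝ) ≤ (1 - δ) * n := by
      have h1 : δ * n * n ^ i ≤ (n - x) * n ^ i := by
        have : δ * n * n ^ i = δ * (n : ℝ) ^ (i + 1) := by ring
        rw [this]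
        change δ * (n : ℝ) ^ (i + 1) < #{B ∈ _ | S B ≠ col A₀} at hbad
        linarith
      have := le_of_mul_le_mul_right h1 (by positivity)
      linarith
    have hx2' : ((i : ℝ) + 1 + 1) * #{A ∈ F | col A = col A₀} ≤
      (x + 1) * #(∂ ({A ∈ F | col A = col A₀} : Finset (Finset (Fin n)))) := by exact_mod_cast hx2
    calc ((i : ℝ) + 2) * #{A ∈ F | col A = col A₀}
        = ((i : ℝ) + 1 + 1) * #{A ∈ F | col A = col A₀} := by ring
      _ ≤ _ := hx2'
      _ ≤ _ := by gcongr
  have hsumF : (#F : ℝ) = ∑ T ∈ F.image col, (#{A ∈ F | col A = T} : ℝ) := by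
    exact_mod_cast card_eq_sum_card_fiberwise (fun A hA => mem_image_of_mem col hA)
  have hsumP : ∑ T ∈ F.image col, (#{B ∈ univ.powersetCard (i + 1) | S B = T} : ℝ) ≤
      n.choose (i + 1) := by
    have h := sum_card_fiberwise_eq_card_filter ((univ : Finset (Fin n)).powersetCard (i + 1))
      (F.image col) S
    have h2 := card_filter_le ((univ : Finset (Fin n)).powersetCard (i + 1))
      (fun B => S B ∈ F.image col)
    rw [← h, card_powersetCard, card_univ, Fintype.card_fin] at h2
    exact_mod_cast h2
  have hmain : ((i : ℝ) + 2) * #F ≤ ((1 - δ) * n + 1) * n.choose (i + 1) := by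
    have h0 : (0 : ℝ) ≤ (1 - δ) * n + 1 := by
      have : 0 ≤ (1 - δ) * n := mul_nonneg (by linarith) hn0.le
      linarith
    calc ((i : ℝ) + 2) * #F = ∑ T ∈ F.image col, ((i : ℝ) + 2) * #{A ∈ F | col A = T} := by
          rw [hsumF, mul_sum]
      _ ≤ ∑ T ∈ F.image col,
          ((1 - δ) * n + 1) * (#{B ∈ univ.powersetCard (i + 1) | S B = T} : ℝ) :=
        sum_le_sum hclass
      _ = ((1 - δ) * n + 1) * ∑ T ∈ F.image col,
          (#{B ∈ univ.powersetCard (i + 1) | S B = T} : ℝ) := by rw [mul_sum]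
      _ ≤ _ := by gcongr
  have hin' : i + 1 ≤ n := by omega
  have hpascal : (n.choose (i + 2) : ℝ) * (i + 2) = n.choose (i + 1) * (n - (i + 1)) := by
    have := Nat.choose_succ_right_eq n (i + 1)
    have h : ((n - (i + 1) : ℕ) : ℝ) = n - (i + 1) := by push_cast [Nat.cast_sub hin']; ring
    rw [← h]
    have h2 : (i : ℝ) + 2 = ((i + 1 + 1 : ℕ) : ℝ) := by push_cast; ring
    rw [h2]
    exact_mod_cast this
  have hlow := hcn n (1 / 2 * n) (by positivity) (by push_cast; linarith)
  have h1 : ((i : ℝ) + 2) * n.choose (i + 2) ≤ ((1 - δ) * n + 1) * n.choose (i + 1) +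
      δ * c * (1 / 2) ^ (i + 1) / 4 * n ^ (i + 2) := by
    have h := mul_le_mul_of_nonneg_left hcard (show (0 : ℝ) ≤ (i : ℝ) + 2 by positivity)
    have : ((i : ℝ) + 2) * (δ * c * (1 / 2) ^ (i + 1) / (4 * (i + 2)) * n ^ (i + 2)) =
        δ * c * (1 / 2) ^ (i + 1) / 4 * n ^ (i + 2) := by field_simp
    rw [mul_add, this] at h
    linarith
  have h2 : δ * n / 2 * n.choose (i + 1) ≤ δ * c * (1 / 2) ^ (i + 1) / 4 * n ^ (i + 2) := by
    have h3 : δ * n / 2 * n.choose (i + 1) ≤ (δ * n - (i + 2)) * n.choose (i + 1) := by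
      gcongr
      linarith
    linarith
  have h4 : δ * n / 2 * (c * (1 / 2 * n) ^ (i + 1)) ≤ δ * n / 2 * n.choose (i + 1) := by gcongr
  have h5 : δ * n / 2 * (c * (1 / 2 * n) ^ (i + 1)) =
      2 * (δ * c * (1 / 2) ^ (i + 1) / 4 * n ^ (i + 2)) := by ring
  have h6 : 0 < δ * c * (1 / 2) ^ (i + 1) / 4 * (n : ℝ) ^ (i + 2) := by positivity
  linarith

/-! ### Covering designs -/

theorem D_le {α : Type*} [DecidableEq α] {W : Finset α} {m j : ℕ} (hW : #W = m)
    {K : Finset (Finset α)} (hK : ∀ e ∈ K, e ⊆ W ∧ #e = j + 1)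
    (hcov : ∀ B ⊆ W, #B = j → ∃ e ∈ K, B ⊆ e) : D m (j + 1) ≤ #K := by
  set φ := W.equivFinOfCardEq hW
  set ψ : Fin m ↪ α := φ.symm.toEmbedding.trans (Function.Embedding.subtype _)
  have hψW : ∀ i, ψ i ∈ W := fun i => (φ.symm i).2
  have hψ : ∀ e ⊆ W, ∃ e' : Finset (Fin m), e'.map ψ = e := fun e he => by
    refine ⟨univ.filter fun i => ψ i ∈ e, ?_⟩
    ext x
    simp only [mem_map, mem_filter, mem_univ, true_and]
    refine ⟨by rintro ⟨i, hi, rfl⟩; exact hi, fun hx => ?_⟩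
    have : ψ (φ ⟨x, he hx⟩) = x := by simp [ψ]
    exact ⟨φ ⟨x, he hx⟩, this.symm ▸ hx, this⟩
  set H : Finset (Finset (Fin m)) := univ.filter fun e => e.map ψ ∈ K
  have hH : #H ≤ #K :=
    card_le_card_of_injOn (fun e => e.map ψ) (fun e he => (mem_filter.1 he).2)
      (fun _ _ _ _ h => map_injective ψ h)
  refine le_trans (Nat.sInf_le ⟨H, fun e he => ?_, fun B hB => ?_, rfl⟩) hH
  · rw [← card_map ψ]
    exact (hK _ (mem_filter.1 he).2).2
  · obtain ⟨e, heK, hBe⟩ := hcov (B.map ψ)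
      (fun x hx => by obtain ⟨i, -, rfl⟩ := mem_map.1 hx; exact hψW i) (by simpa using hB)
    obtain ⟨e', rfl⟩ := hψ e (hK e heK).1
    exact ⟨e', mem_filter.2 ⟨mem_univ _, heK⟩, map_subset_map.1 hBe⟩

theorem exists_card_eq_D {α : Type*} [DecidableEq α] {W : Finset α} {m j : ℕ} (hW : #W = m)
    (hj : j + 1 ≤ m) : ∃ K : Finset (Finset α), (∀ e ∈ K, e ⊆ W ∧ #e = j + 1) ∧
      (∀ B ⊆ W, #B = j → ∃ e ∈ K, B ⊆ e) ∧ #K = D m (j + 1) := by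
  obtain ⟨H, hH, hcov, hcard⟩ := (D_isLeast (Nat.le_add_left 1 j) hj).1
  set φ := W.equivFinOfCardEq hW
  set ψ : Fin m ↪ α := φ.symm.toEmbedding.trans (Function.Embedding.subtype _)
  refine ⟨H.image fun e => e.map ψ, fun e he => ?_, fun B hB hBj => ?_, ?_⟩
  · obtain ⟨e, he', rfl⟩ := mem_image.1 he
    refine ⟨fun x hx => ?_, by simpa using hH e he'⟩
    obtain ⟨i, -, rfl⟩ := mem_map.1 hx
    exact (φ.symm i).2
  · obtain ⟨B', rfl⟩ : ∃ B' : Finset (Fin m), B'.map ψ = B := by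
      refine ⟨univ.filter fun i => ψ i ∈ B, ?_⟩
      ext x
      simp only [mem_map, mem_filter, mem_univ, true_and]
      refine ⟨by rintro ⟨i, hi, rfl⟩; exact hi, fun hx => ?_⟩
      have : ψ (φ ⟨x, hB hx⟩) = x := by simp [ψ]
      exact ⟨φ ⟨x, hB hx⟩, this.symm ▸ hx, this⟩
    obtain ⟨e, he, hBe⟩ := hcov B' (by simpa using hBj)
    exact ⟨e.map ψ, mem_image_of_mem _ he, map_subset_map.2 hBe⟩
  · rw [card_image_of_injective _ (map_injective ψ), hcard]

/-- The `(i + 2)`-sets of residues modulo `m` with a prescribed sum cover the `(i + 1)`-sets with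
almost no overlap, so they give a covering design within a lower-order term of the trivial bound.
The `(i + 1)`-sets missed are those for which the residue to be added is already present; averaging
over the prescribed sum shows that these may be taken to be few. -/
theorem mul_D_le {m i : ℕ} (hm : i + 2 ≤ m) :
    (i + 2) * D m (i + 2) ≤ m.choose (i + 1) + (i + 2) * ((i + 1) * m ^ i) := by
  have : NeZero m := ⟨by omega⟩
  set P : Finset (Finset (Fin m)) := univ.powersetCard (i + 1) with hP
  have hPc : #P = m.choose (i + 1) := by simp [hP]
  set miss : Fin m → Finset (Finset (Fin m)) := fun c => P.filter fun B => c - ∑ x ∈ B, x ∈ B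
  have hsum : ∑ c, #(miss c) = #P * (i + 1) := by
    have h := sum_card_bipartiteAbove_eq_sum_card_bipartiteBelow (s := univ) (t := P)
      (fun (c : Fin m) (B : Finset (Fin m)) => c - ∑ x ∈ B, x ∈ B)
    refine h.trans (sum_const_nat fun B hB => ?_)
    rw [← (mem_powersetCard.1 hB).2]
    refine card_nbij (fun c => c - ∑ x ∈ B, x) (fun c hc => (mem_filter.1 hc).2)
      (fun c _ c' _ h => sub_left_injective h) (fun x hx => ⟨x + ∑ x ∈ B, x, ?_, by simp⟩)
    simpa using hx
  obtain ⟨c, -, hc⟩ : ∃ c ∈ (univ : Finset (Fin m)), m * #(miss c) ≤ #P * (i + 1) := by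
    refine exists_le_of_sum_le ⟨0, mem_univ _⟩ ?_
    rw [← mul_sum, hsum, sum_const, card_univ, Fintype.card_fin, smul_eq_mul]
  have hmiss : #(miss c) ≤ (i + 1) * m ^ i := by
    refine Nat.le_of_mul_le_mul_left (hc.trans ?_) (show 0 < m by omega)
    calc #P * (i + 1) ≤ m ^ (i + 1) * (i + 1) :=
          Nat.mul_le_mul_right _ (hPc ▸ Nat.choose_le_pow _ _)
      _ = _ := by ring
  set K₁ : Finset (Finset (Fin m)) := (univ.powersetCard (i + 2)).filter fun e => ∑ x ∈ e, x = c
  have hK₁ : #K₁ * (i + 2) ≤ #P * 1 := by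
    refine card_mul_le_card_mul (fun e B => B ⊆ e) (fun e he => ?_) (fun B hB => ?_)
    · have hec : #e = i + 2 := (mem_powersetCard.1 (mem_filter.1 he).1).2
      have : bipartiteAbove (fun e B : Finset (Fin m) => B ⊆ e) P e = e.powersetCard (i + 1) := by
        ext B
        simp [hP, mem_powersetCard, and_comm]
      rw [this, card_powersetCard, hec, Nat.choose_succ_self_right]
    · refine card_le_one.2 fun e he e' he' => ?_
      have key : ∀ e ∈ bipartiteBelow (fun e B : Finset (Fin m) => B ⊆ e) K₁ B,
          e = insert (c - ∑ x ∈ B, x) B := fun e he => by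
        obtain ⟨he, hBe⟩ := mem_filter.1 he
        obtain ⟨hec, hes⟩ := mem_filter.1 he
        obtain ⟨x, hx, rfl⟩ := (exists_eq_insert_iff (s := B) (t := e)).2
          ⟨hBe, by rw [(mem_powersetCard.1 hec).2, (mem_powersetCard.1 hB).2]⟩
        rw [sum_insert hx] at hes
        rw [← hes, add_sub_cancel_right]
      rw [key e he, key e' he']
  have hext : ∀ B ∈ P, ∃ e : Finset (Fin m), B ⊆ e ∧ #e = i + 2 := fun B hB => by
    obtain ⟨e, hBe, -, he⟩ := exists_subsuperset_card_eq (subset_univ B)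
      (show #B ≤ i + 2 by rw [(mem_powersetCard.1 hB).2]; omega) (by simpa using hm)
    exact ⟨e, hBe, he⟩
  choose! E hE using hext
  have hD : D m (i + 2) ≤ #(K₁ ∪ (miss c).image E) := by
    refine D_le (W := univ) (by simp) (fun e he => ⟨subset_univ _, ?_⟩) fun B _ hB => ?_
    · rcases mem_union.1 he with h | h
      · exact (mem_powersetCard.1 (mem_filter.1 h).1).2
      · obtain ⟨B, hB, rfl⟩ := mem_image.1 h
        exact (hE B (mem_filter.1 hB).1).2
    · have hBP : B ∈ P := mem_powersetCard.2 ⟨subset_univ _, hB⟩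
      by_cases h : c - ∑ x ∈ B, x ∈ B
      · exact ⟨E B, mem_union_right _ (mem_image_of_mem _ (mem_filter.2 ⟨hBP, h⟩)), (hE B hBP).1⟩
      · refine ⟨insert (c - ∑ x ∈ B, x) B, mem_union_left _ (mem_filter.2 ⟨mem_powersetCard.2
          ⟨subset_univ _, by rw [card_insert_of_notMem h, hB]⟩, ?_⟩), subset_insert _ _⟩
        rw [sum_insert h, sub_add_cancel]
  have hD' : D m (i + 2) ≤ #K₁ + #(miss c) :=
    hD.trans ((card_union_le _ _).trans (Nat.add_le_add_left card_image_le _))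
  calc (i + 2) * D m (i + 2) ≤ (i + 2) * (#K₁ + #(miss c)) := Nat.mul_le_mul_left _ hD'
    _ = #K₁ * (i + 2) + (i + 2) * #(miss c) := by ring
    _ ≤ _ := Nat.add_le_add (by rw [← hPc]; simpa using hK₁) (Nat.mul_le_mul_left _ hmiss)

/-! ### Hypergraphs containing every edge that meets a core -/

theorem g_eq (n j t : ℕ) :
    g n (j + t) (j + 1) = n.choose (j + 1) - (n - t).choose (j + 1) + D (n - t) (j + 1) := by
  rw [g, show j + t + 1 - (j + 1) = t by omega]

theorem card_core {n j t : ℕ} (ht : t ≤ n) : #(core n (j + t) (j + 1)) = t := by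
  rw [core, show j + t + 1 - (j + 1) = t by omega, Fin.card_filter_val_lt]
  omega

theorem card_filter_not_disjoint {n r : ℕ} (T : Finset (Fin n)) :
    #{e ∈ univ.powersetCard r | ¬ Disjoint e T} = n.choose r - (n - #T).choose r := by
  have h := card_filter_add_card_filter_not (s := (univ : Finset (Fin n)).powersetCard r)
    (fun e => Disjoint e T)
  have h2 : {e ∈ (univ : Finset (Fin n)).powersetCard r | Disjoint e T} = Tᶜ.powersetCard r := by
    ext e
    simp [mem_powersetCard, and_comm, subset_compl_iff_disjoint_right]
  rw [h2, card_powersetCard, card_powersetCard, card_compl, card_univ, Fintype.card_fin] at h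
  omega

/-- The members of the extremal family cover every `(j + t)`-set. -/
theorem everyCovered_union {n j t : ℕ} {T : Finset (Fin n)} (hT : #T = t)
    {C : Finset (Finset (Fin n))} (hC : ∀ e ∈ C, #e = j + 1 ∧ Disjoint e T)
    (hcov : ∀ B : Finset (Fin n), #B = j → Disjoint B T → ∃ e ∈ C, B ⊆ e) :
    EveryCovered (j + t) (j + 1)
      ((univ.powersetCard (j + 1)).filter (fun e => ¬ Disjoint e T) ∪ C) := by
  refine ⟨fun e he => ?_, fun A hA => ?_⟩
  · rcases mem_union.1 he with h | h
    · exact (mem_powersetCard.1 (mem_filter.1 h).1).2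
    · exact (hC e h).1
  have meet : ∀ (B : Finset (Fin n)) (u : Fin n), #B = j → u ∉ B → ¬ Disjoint (insert u B) T →
      insert u B ∈ (univ.powersetCard (j + 1)).filter (fun e => ¬ Disjoint e T) ∪ C := fun B u hB hu h =>
    mem_union_left _ (mem_filter.2 ⟨mem_powersetCard.2 ⟨subset_univ _, by
      rw [card_insert_of_notMem hu, hB]⟩, h⟩)
  by_cases hTA : T ⊆ A
  · -- Only the `j`-set `A \ T` has to be extended by an edge outside the core.
    have hBc : #(A \ T) = j := by rw [card_sdiff_of_subset hTA, hA, hT]; omega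
    obtain ⟨e, heC, hBe⟩ := hcov (A \ T) hBc sdiff_disjoint
    obtain ⟨u, hu, rfl⟩ := (exists_eq_insert_iff (s := A \ T) (t := e)).2
      ⟨hBe, by rw [(hC e heC).1, hBc]⟩
    have huT : u ∉ T := fun h => disjoint_left.1 (hC _ heC).2 (mem_insert_self _ _) h
    have huA : u ∉ A := fun h => hu (mem_sdiff.2 ⟨h, huT⟩)
    refine ⟨u, huA, fun B hB => ?_⟩
    obtain ⟨hBA, hBj⟩ := mem_powersetCard.1 hB
    by_cases hBT : Disjoint B T
    · have : B = A \ T := eq_of_subset_of_card_le (subset_sdiff.2 ⟨hBA, hBT⟩) (by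
        rw [hBc, hBj]; rfl)
      rw [this]
      exact mem_union_right _ heC
    · exact meet B u hBj (fun h => huA (hBA h)) fun h =>
        hBT (h.mono_left (subset_insert _ _))
  · obtain ⟨u, huT, huA⟩ := not_subset.1 hTA
    refine ⟨u, huA, fun B hB => ?_⟩
    obtain ⟨hBA, hBj⟩ := mem_powersetCard.1 hB
    exact meet B u hBj (fun h => huA (hBA h)) fun h =>
      disjoint_left.1 h (mem_insert_self _ _) huT

theorem f_le_g {n j t : ℕ} (hn : j + t < n) : f n (j + t) (j + 1) ≤ g n (j + t) (j + 1) := by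
  set T := core n (j + t) (j + 1)
  have hT : #T = t := card_core (by omega)
  obtain ⟨C, hC, hcov, hCc⟩ := exists_card_eq_D (W := Tᶜ) (m := n - t) (j := j)
    (by rw [card_compl, hT, Fintype.card_fin]) (by omega)
  have hH := everyCovered_union hT (C := C) (j := j)
    (fun e he => ⟨(hC e he).2, subset_compl_iff_disjoint_right.1 (hC e he).1⟩)
    (fun B hB hBT => hcov B (subset_compl_iff_disjoint_right.2 hBT) hB)
  refine le_trans (Nat.sInf_le ⟨_, hH, rfl⟩) ((card_union_le _ _).trans ?_)
  rw [card_filter_not_disjoint, hT, hCc, g_eq]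

/-- In the trace of `H` outside a `t`-set `T`, every `j`-set is contained in an edge, since it is
completed by a vertex covering its union with `T`. -/
theorem EveryCovered.exists_disjoint_superset {n j t : ℕ} {H : Finset (Finset (Fin n))}
    (hH : EveryCovered (j + t) (j + 1) H) {T : Finset (Fin n)} (hT : #T = t)
    {B : Finset (Fin n)} (hB : #B = j) (hBT : Disjoint B T) :
    ∃ e ∈ {e ∈ H | Disjoint e T}, B ⊆ e := by
  obtain ⟨u, hu, hcov⟩ := hH.2 (B ∪ T) (by rw [card_union_of_disjoint hBT, hB, hT])
  rw [mem_union, not_or] at hu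
  exact ⟨insert u B, mem_filter.2 ⟨hcov B (mem_powersetCard.2 ⟨subset_union_left, hB⟩),
    disjoint_insert_left.2 ⟨hu.2, hBT⟩⟩, subset_insert _ _⟩

theorem EveryCovered.D_le_card {n j t : ℕ} {H : Finset (Finset (Fin n))}
    (hH : EveryCovered (j + t) (j + 1) H) {T : Finset (Fin n)} (hT : #T = t) :
    D (n - t) (j + 1) ≤ #{e ∈ H | Disjoint e T} :=
  D_le (W := Tᶜ) (by rw [card_compl, hT, Fintype.card_fin])
    (fun e he => ⟨subset_compl_iff_disjoint_right.2 (mem_filter.1 he).2, hH.1 e (mem_filter.1 he).1⟩)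
    (fun _ hB hBj => hH.exists_disjoint_superset hT hBj (subset_compl_iff_disjoint_right.1 hB))

theorem card_add_card_missing {n j : ℕ} {H : Finset (Finset (Fin n))}
    (hH : ∀ e ∈ H, #e = j + 1) (T : Finset (Fin n)) :
    #H + #{e ∈ univ.powersetCard (j + 1) | ¬ Disjoint e T ∧ e ∉ H} =
      n.choose (j + 1) - (n - #T).choose (j + 1) + #{e ∈ H | Disjoint e T} := by
  have h1 := card_filter_add_card_filter_not (s := H) (fun e => Disjoint e T)
  have h2 := card_filter_add_card_filter_not
    (s := {e ∈ (univ : Finset (Fin n)).powersetCard (j + 1) | ¬ Disjoint e T}) (fun e => e ∈ H)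
  rw [card_filter_not_disjoint, filter_filter, filter_filter] at h2
  have h3 : {e ∈ (univ : Finset (Fin n)).powersetCard (j + 1) | ¬ Disjoint e T ∧ e ∈ H} =
      {e ∈ H | ¬ Disjoint e T} := by
    ext e
    simp only [mem_filter, mem_powersetCard, subset_univ, true_and]
    exact ⟨fun h => ⟨h.2.2, h.2.1⟩, fun h => ⟨hH e h.1, h.2, h.1⟩⟩
  rw [h3] at h2
  omega

theorem EveryCovered.image_map {V W : Type*} [DecidableEq V] [DecidableEq W] {k r : ℕ}
    {H : Finset (Finset V)} (hH : EveryCovered k r H) (σ : V ≃ W) :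
    EveryCovered k r (H.image fun e => e.map σ.toEmbedding) := by
  refine ⟨fun e he => ?_, fun A hA => ?_⟩
  · obtain ⟨e, he', rfl⟩ := mem_image.1 he
    simpa using hH.1 e he'
  · obtain ⟨u, hu, hcov⟩ := hH.2 (A.map σ.symm.toEmbedding) (by simpa using hA)
    refine ⟨σ u, fun h => hu (by simpa using h), fun B hB => ?_⟩
    obtain ⟨hBA, hBr⟩ := mem_powersetCard.1 hB
    refine mem_image.2 ⟨_, hcov (B.map σ.symm.toEmbedding)
      (mem_powersetCard.2 ⟨map_subset_map.2 hBA, by simpa using hBr⟩), ?_⟩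
    simp [map_insert, map_map]

theorem Isomorphic.trans {U V W : Type*} [DecidableEq V] [DecidableEq W] {H : Finset (Finset U)}
    {K : Finset (Finset V)} {L : Finset (Finset W)} (h₁ : Isomorphic H K) (h₂ : Isomorphic K L) :
    Isomorphic H L := by
  obtain ⟨σ, rfl⟩ := h₁
  obtain ⟨τ, rfl⟩ := h₂
  refine ⟨σ.trans τ, ?_⟩
  rw [image_image]
  congr 1
  ext e
  simp [map_map]

/-- If `H` contains all the `(j + 1)`-sets meeting some `t`-set and has at most `g` edges, then it
is isomorphic to a member of the extremal family. -/
theorem EveryCovered.conclusion {n j t : ℕ} {H : Finset (Finset (Fin n))}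
    (hH : EveryCovered (j + t) (j + 1) H) {T : Finset (Fin n)} (hT : #T = t)
    (hfull : ∀ e : Finset (Fin n), #e = j + 1 → ¬ Disjoint e T → e ∈ H)
    (hg : #H ≤ g n (j + t) (j + 1)) :
    #H = g n (j + t) (j + 1) ∧ ∃ G ∈ family n (j + t) (j + 1), Isomorphic H G := by
  have htn : t ≤ n := by simpa [hT] using card_le_univ T
  have hcard : ∀ (K : Finset (Finset (Fin n))) (S : Finset (Fin n)), #S = t →
      (∀ e ∈ K, #e = j + 1) → (∀ e : Finset (Fin n), #e = j + 1 → ¬ Disjoint e S → e ∈ K) →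
      #K = n.choose (j + 1) - (n - t).choose (j + 1) + #{e ∈ K | Disjoint e S} := by
    intro K S hS hK hKS
    have h := card_add_card_missing hK S
    rw [filter_false_of_mem, card_empty, hS] at h
    · simpa using h
    · exact fun e he h => h.2 (hKS e (mem_powersetCard.1 he).2 h.1)
  have hge := hH.D_le_card hT
  have hHc := hcard H T hT hH.1 hfull
  rw [g_eq] at hg ⊢
  have hEq : #H = n.choose (j + 1) - (n - t).choose (j + 1) + D (n - t) (j + 1) := by omega
  refine ⟨hEq, ?_⟩
  set Q := core n (j + t) (j + 1)
  have hQ : #Q = t := card_core htn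
  have e₀ : {x // x ∈ T} ≃ {x // x ∈ Q} := T.equivOfCardEq (hT.trans hQ.symm)
  set σ : Fin n ≃ Fin n := e₀.extendSubtype
  have hσ : ∀ x, σ x ∈ Q ↔ x ∈ T := fun x =>
    ⟨fun h => by_contra fun hx => e₀.extendSubtype_not_mem x hx h, e₀.extendSubtype_mem x⟩
  have hσQ : T.map σ.toEmbedding = Q := eq_of_subset_of_card_le
    (fun x hx => by obtain ⟨y, hy, rfl⟩ := mem_map.1 hx; exact (hσ y).2 hy)
    (by rw [card_map, hT, hQ])
  set G := H.image fun e => e.map σ.toEmbedding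
  have hG : EveryCovered (j + t) (j + 1) G := hH.image_map σ
  have hGfull : ∀ e : Finset (Fin n), #e = j + 1 → ¬ Disjoint e Q → e ∈ G := by
    intro e he heQ
    refine mem_image.2 ⟨e.map σ.symm.toEmbedding, hfull _ (by simpa using he) fun h => heQ ?_, ?_⟩
    · rw [← hσQ]
      have := (disjoint_map σ.toEmbedding).2 h
      simpa [map_map] using this
    · simp [map_map]
  have hGc := hcard G Q hQ hG.1 hGfull
  have hGH : #G = #H := card_image_of_injective _ (map_injective _)
  refine ⟨G, ⟨{e ∈ G | Disjoint e Q}, fun e he => ?_, fun B hB hBQ => ?_, ?_, ?_⟩, σ, rfl⟩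
  · exact ⟨hG.1 e (mem_filter.1 he).1, (mem_filter.1 he).2⟩
  · exact hG.exists_disjoint_superset hQ hB hBQ
  · rw [show j + t + 1 - (j + 1) = t by omega]
    omega
  · ext e
    simp only [mem_union, mem_filter, mem_powersetCard, subset_univ, true_and]
    constructor
    · intro he
      by_cases h : Disjoint e Q
      · exact Or.inr ⟨he, h⟩
      · exact Or.inl ⟨hG.1 e he, h⟩
    · rintro (h | h)
      · exact hGfull e h.1 h.2
      · exact h.1

/-! ### Saving edges around badly covered sets -/

/-- The sets `C ∪ {w}` with `w ∈ Y` can be covered two at a time by sets `C ∪ {w, w'}`. -/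
theorem exists_pairing {α : Type*} [DecidableEq α] {W C : Finset α} {i : ℕ} (hC : #C = i)
    (hCW : C ⊆ W) (Y : Finset α) (hY : Y ⊆ W \ C) (hne : ∀ y ∈ Y, ∃ y' ∈ W \ C, y' ≠ y) :
    ∃ Q : Finset (Finset α), (∀ e ∈ Q, e ⊆ W ∧ #e = i + 2) ∧
      (∀ w ∈ Y, ∃ e ∈ Q, insert w C ⊆ e) ∧ 2 * #Q ≤ #Y + 1 := by
  have hedge : ∀ y ∈ W \ C, ∀ y' ∈ W \ C, y' ≠ y →
      insert y (insert y' C) ⊆ W ∧ #(insert y (insert y' C)) = i + 2 := by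
    intro y hy y' hy' h
    rw [mem_sdiff] at hy hy'
    refine ⟨insert_subset hy.1 (insert_subset hy'.1 hCW), ?_⟩
    rw [card_insert_of_notMem, card_insert_of_notMem hy'.2, hC]
    rw [mem_insert, not_or]
    exact ⟨h.symm, hy.2⟩
  induction Y using Finset.strongInduction with
  | H Y ih =>
    rcases Y.eq_empty_or_nonempty with rfl | ⟨y, hy⟩
    · exact ⟨∅, by simp, by simp, by simp⟩
    rcases (Y.erase y).eq_empty_or_nonempty with h | ⟨y', hy'⟩
    · obtain ⟨y', hy', hyy'⟩ := hne y hy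
      refine ⟨{insert y (insert y' C)}, fun e he => ?_, fun w hw => ?_, ?_⟩
      · rw [mem_singleton.1 he]
        exact hedge y (hY hy) y' hy' hyy'
      · have hwy : w = y := by
          by_contra hwy
          have := mem_erase.2 ⟨hwy, hw⟩
          simp [h] at this
        subst hwy
        exact ⟨_, mem_singleton_self _, insert_subset_insert _ (subset_insert _ _)⟩
      · have := card_pos.2 ⟨y, hy⟩
        rw [card_singleton]
        omega
    · have hss : (Y.erase y).erase y' ⊂ Y :=
        (erase_subset _ _).trans_ssubset (erase_ssubset hy)
      obtain ⟨Q, hQ, hQc, hQ2⟩ := ih _ hss (hss.1.trans hY) fun z hz => hne z (hss.1 hz)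
      have hcard : #((Y.erase y).erase y') + 2 = #Y := by
        have h1 := card_erase_add_one hy
        have h2 := card_erase_add_one hy'
        omega
      obtain ⟨hyy', hy'Y⟩ := mem_erase.1 hy'
      refine ⟨insert (insert y (insert y' C)) Q, fun e he => ?_, fun w hw => ?_, ?_⟩
      · rcases mem_insert.1 he with rfl | he
        · exact hedge y (hY hy) y' (hY hy'Y) hyy'
        · exact hQ e he
      · by_cases h1 : w = y
        · subst h1
          exact ⟨_, mem_insert_self _ _, insert_subset_insert _ (subset_insert _ _)⟩
        by_cases h2 : w = y'
        · subst h2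
          exact ⟨_, mem_insert_self _ _, subset_insert _ _⟩
        · obtain ⟨e, he, hwe⟩ := hQc w (mem_erase.2 ⟨h2, mem_erase.2 ⟨h1, hw⟩⟩)
          exact ⟨e, mem_insert_of_mem he, hwe⟩
      · have := card_insert_le (insert y (insert y' C)) Q
        omega

/-- Let `K` be a covering design on `W`, and call an `(i + 1)`-set bad if for each further `w` some
vertex covers, through edges of `K`, its union with `w`. Then `K` wastes linearly many edges for
each set `C` in the shadow of the bad sets.

Fix `b` with `C ∪ {b}` bad. For every `w` there is `u` such that the edge `C ∪ {w, u}` is needed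
only for covering `C ∪ {w}`: its other `(i + 1)`-subsets are covered by edges containing `b`.
These edges can be replaced by about half as many edges `C ∪ {w, w'}`. To do this for all `C`
simultaneously, fix a set `Z` and treat only those cases in which `b ∈ Z` and `C ∪ {w, u}` is
disjoint from `Z`; then the edges deleted avoid `Z` while the edges relied upon meet `Z`. Averaging
over `Z` shows that a constant proportion of the cases can be treated. -/
theorem exists_saving {α : Type*} [DecidableEq α] {W : Finset α} {m i : ℕ} (hW : #W = m)
    {K P : Finset (Finset α)} (hK : ∀ e ∈ K, e ⊆ W ∧ #e = i + 2)
    (hcov : ∀ B ⊆ W, #B = i + 1 → ∃ e ∈ K, B ⊆ e) (hP : ∀ B ∈ P, B ⊆ W ∧ #B = i + 1)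
    (hbad : ∀ B ∈ P, ∀ w ∈ W, w ∉ B → ∃ u ∈ W, u ∉ B ∧ u ≠ w ∧
      ∀ B' ⊆ insert w B, #B' = i + 1 → insert u B' ∈ K) :
    ∃ q : ℕ, 2 * D m (i + 2) + q ≤ 2 * #K + #(∂ P) ∧
      #(∂ P) * (m - (i + 1)) ≤ 2 ^ (i + 3) * ((i + 2) ^ 2 * q) := by
  have hb : ∀ C ∈ ∂ P, ∃ b, b ∉ C ∧ insert b C ∈ P := fun C hC => by
    obtain ⟨b, hb⟩ := mem_shadow_iff_insert_mem.1 hC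
    exact ⟨b, hb⟩
  have hbad' : ∀ B ∈ P, ∀ w, ∃ u, w ∈ W → w ∉ B → u ∈ W ∧ u ∉ B ∧ u ≠ w ∧
      ∀ B' ⊆ insert w B, #B' = i + 1 → insert u B' ∈ K := fun B hB w => by
    by_cases h : w ∈ W ∧ w ∉ B
    · obtain ⟨u, hu⟩ := hbad B hB w h.1 h.2
      exact ⟨u, fun _ _ => hu⟩
    · exact ⟨w, fun h1 h2 => absurd ⟨h1, h2⟩ h⟩
  rcases (∂ P).eq_empty_or_nonempty with h0 | ⟨C₀, hC₀⟩
  · refine ⟨0, ?_, by simp [h0]⟩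
    have : D m (i + 2) ≤ #K := D_le hW hK hcov
    omega
  have : Nonempty α := ⟨(hb C₀ hC₀).choose⟩
  choose! b hbC hbP using hb
  choose! u₀ hu₀ using hbad'
  set u : Finset α × α → α := fun p => u₀ (insert (b p.1) p.1) p.2
  set pairs : Finset (Finset α × α) := (∂ P ×ˢ W).filter fun p => p.2 ∉ insert (b p.1) p.1
  set E : Finset α × α → Finset α := fun p => insert (u p) (insert p.2 p.1)
  have hCi : ∀ C ∈ ∂ P, #C = i := fun C hC => by
    have := (hP _ (hbP C hC)).2
    rw [card_insert_of_notMem (hbC C hC)] at this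
    omega
  have hpair : ∀ p ∈ pairs, p.1 ∈ ∂ P ∧ p.2 ∈ W ∧ p.2 ≠ b p.1 ∧ p.2 ∉ p.1 ∧ u p ∈ W ∧
      u p ≠ b p.1 ∧ u p ∉ p.1 ∧ u p ≠ p.2 ∧
      ∀ B' ⊆ insert p.2 (insert (b p.1) p.1), #B' = i + 1 → insert (u p) B' ∈ K := by
    intro p hp
    obtain ⟨h1, h2⟩ := mem_filter.1 hp
    obtain ⟨hC, hw⟩ := mem_product.1 h1
    obtain ⟨h3, h4, h5, h6⟩ := hu₀ _ (hbP _ hC) _ hw h2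
    rw [mem_insert, not_or] at h2 h4
    exact ⟨hC, hw, h2.1, h2.2, h3, h4.1, h4.2, h5, h6⟩
  have hpairs : #pairs = #(∂ P) * (m - (i + 1)) := by
    have : pairs = ((∂ P).sigma (fun C => W \ insert (b C) C)).map
        (Equiv.sigmaEquivProd _ _).toEmbedding := by
      ext ⟨C, w⟩
      simp only [pairs, mem_filter, mem_product, mem_map_equiv, mem_sigma, mem_sdiff,
        Equiv.sigmaEquivProd_symm_apply]
      tauto
    rw [this, card_map, card_sigma]
    refine sum_const_nat fun C hC => ?_
    rw [card_sdiff_of_subset (hP _ (hbP C hC)).1, hW, (hP _ (hbP C hC)).2]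
  have hEc : ∀ p ∈ pairs, #(E p) = i + 2 := fun p hp => by
    obtain ⟨hC, -, -, hw, -, -, hu, huw, -⟩ := hpair p hp
    rw [card_insert_of_notMem, card_insert_of_notMem hw, hCi _ hC]
    rw [mem_insert, not_or]
    exact ⟨huw, hu⟩
  have hEK : ∀ p ∈ pairs, E p ∈ K := fun p hp => by
    obtain ⟨hC, -, -, hw, -, -, -, -, h⟩ := hpair p hp
    exact h _ (insert_subset_insert _ (subset_insert _ _))
      (by rw [card_insert_of_notMem hw, hCi _ hC])
  set good : Finset α → Finset (Finset α × α) := fun Z =>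
    pairs.filter fun p => b p.1 ∈ Z ∧ Disjoint (E p) Z
  obtain ⟨Z, -, hZ⟩ : ∃ Z ∈ W.powerset, #pairs ≤ 2 ^ (i + 3) * #(good Z) := by
    refine exists_le_of_sum_le ⟨∅, empty_mem_powerset _⟩ ?_
    rw [sum_const, card_powerset, hW, smul_eq_mul, ← mul_sum]
    have h := sum_card_bipartiteAbove_eq_sum_card_bipartiteBelow (s := W.powerset) (t := pairs)
      (fun (Z : Finset α) p => b p.1 ∈ Z ∧ Disjoint (E p) Z)
    change ∑ Z ∈ W.powerset, #(good Z) = _ at h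
    rw [h, mul_sum, mul_comm, ← smul_eq_mul, ← sum_const]
    refine sum_le_sum fun p hp => ?_
    obtain ⟨hC, hw, hwb, hwC, huW, hub, huC, huw, -⟩ := hpair p hp
    have hbW : b p.1 ∈ W := (hP _ (hbP _ hC)).1 (mem_insert_self _ _)
    have hbE : b p.1 ∉ E p := by
      simp only [E, mem_insert, not_or]
      exact ⟨hub.symm, hwb.symm, hbC _ hC⟩
    have hEW : E p ⊆ W := (hK _ (hEK p hp)).1
    have hIcc : W.powerset.bipartiteBelow (fun Z p => b p.1 ∈ Z ∧ Disjoint (E p) Z) p =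
        Icc {b p.1} (W \ E p) := by
      ext Z
      simp only [mem_bipartiteBelow, mem_powerset, mem_Icc, singleton_subset_iff,
        subset_sdiff, disjoint_comm (a := E p)]
      tauto
    have hlt : i + 3 ≤ m := by
      have := card_le_card (insert_subset hbW hEW)
      rw [card_insert_of_notMem hbE, hEc p hp, hW] at this
      omega
    rw [hIcc, card_Icc_finset (singleton_subset_iff.2 (mem_sdiff.2 ⟨hbW, hbE⟩)),
      card_sdiff_of_subset hEW, hW, hEc p hp, card_singleton, ← pow_add]
    exact Nat.pow_le_pow_right (by norm_num) (by omega)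
  set X := (good Z).image E
  have hgp : ∀ p ∈ good Z, p ∈ pairs := fun p hp => (mem_filter.1 hp).1
  have hX : #(good Z) ≤ (i + 2) ^ 2 * #X := by
    refine card_le_mul_card_image _ _ fun e he => ?_
    obtain ⟨p₀, hp₀, rfl⟩ := mem_image.1 he
    rw [← hEc p₀ (hgp _ hp₀), sq, ← card_product]
    have hCE : ∀ p ∈ good Z, p.1 = ((E p).erase (u p)).erase p.2 := fun p hp => by
      obtain ⟨-, -, -, hwC, -, -, huC, huw, -⟩ := hpair p (hgp p hp)
      rw [erase_insert, erase_insert hwC]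
      rw [mem_insert, not_or]
      exact ⟨huw, huC⟩
    refine card_le_card_of_injOn (fun p => (p.2, u p)) (fun p hp => ?_) fun p hp p' hp' h => ?_
    · obtain ⟨-, hpe⟩ := mem_filter.1 hp
      rw [← hpe]
      simp [E]
    · obtain ⟨hpg, hpe⟩ := mem_filter.1 hp
      obtain ⟨hpg', hpe'⟩ := mem_filter.1 hp'
      obtain ⟨h1, h2⟩ := Prod.mk.inj h
      refine Prod.ext ?_ h1
      rw [hCE p hpg, hCE p' hpg', hpe, hpe', h1, h2]
  have hrep : ∀ e ∈ X, ∃ p ∈ good Z, E p = e := fun e he => mem_image.1 he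
  choose! ρ hρ hρE using hrep
  set Y : Finset α → Finset α := fun C => (X.filter fun e => (ρ e).1 = C).image fun e => (ρ e).2
  have hQ : ∀ C ∈ ∂ P, ∃ Q : Finset (Finset α), (∀ e ∈ Q, e ⊆ W ∧ #e = i + 2) ∧
      (∀ w ∈ Y C, ∃ e ∈ Q, insert w C ⊆ e) ∧ 2 * #Q ≤ #(Y C) + 1 := fun C hC => by
    refine exists_pairing (hCi C hC) ((subset_insert _ _).trans (hP _ (hbP C hC)).1) _
      (fun w hw => ?_) fun w hw => ?_
    all_goals
      obtain ⟨e, he, rfl⟩ := mem_image.1 hw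
      obtain ⟨heX, rfl⟩ := mem_filter.1 he
      obtain ⟨-, hwW, -, hwC, huW, -, huC, huw, -⟩ := hpair _ (hgp _ (hρ e heX))
    · exact mem_sdiff.2 ⟨hwW, hwC⟩
    · exact ⟨_, mem_sdiff.2 ⟨huW, huC⟩, huw⟩
  choose! Q hQW hQc hQ2 using hQ
  set N := (∂ P).biUnion Q
  have hN : 2 * #N ≤ #X + #(∂ P) := by
    calc 2 * #N ≤ 2 * ∑ C ∈ ∂ P, #(Q C) := Nat.mul_le_mul_left _ card_biUnion_le
      _ = ∑ C ∈ ∂ P, 2 * #(Q C) := mul_sum _ _ _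
      _ ≤ ∑ C ∈ ∂ P, (#(X.filter fun e => (ρ e).1 = C) + 1) :=
        sum_le_sum fun C hC => (hQ2 C hC).trans (Nat.add_le_add_right card_image_le _)
      _ = #X + #(∂ P) := by
        rw [sum_add_distrib, sum_const, smul_eq_mul, mul_one]
        congr 1
        exact (card_eq_sum_card_fiberwise fun e he => (hpair _ (hgp _ (hρ e he))).1).symm
  have hXK : X ⊆ K := fun e he => by
    obtain ⟨p, hp, rfl⟩ := mem_image.1 he
    exact hEK p (hgp p hp)
  have hD : D m (i + 2) ≤ #(K \ X ∪ N) := by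
    refine D_le hW (fun e he => ?_) fun B hBW hB => ?_
    · rcases mem_union.1 he with h | h
      · exact hK e (mem_sdiff.1 h).1
      · obtain ⟨C, hC, heC⟩ := mem_biUnion.1 h
        exact hQW C hC e heC
    obtain ⟨e, heK, hBe⟩ := hcov B hBW hB
    by_cases heX : e ∈ X
    swap
    · exact ⟨e, mem_union_left _ (mem_sdiff.2 ⟨heK, heX⟩), hBe⟩
    obtain ⟨hbZ, hEZ⟩ := (mem_filter.1 (hρ e heX)).2
    obtain ⟨hC, hwW, hwb, hwC, huW, hub, huC, huw, hcl⟩ := hpair _ (hgp _ (hρ e heX))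
    have hei : #e = i + 2 := (hK e heK).2
    have hEe := hρE e heX
    set p := ρ e
    obtain ⟨x, hx, hxe⟩ := (exists_eq_insert_iff (s := B) (t := e)).2
      ⟨hBe, by rw [hB, hei]⟩
    have hBx : B = e.erase x := by rw [← hxe, erase_insert hx]
    -- An edge containing `b` has not been deleted.
    have keep : ∀ B' ⊆ insert p.2 (insert (b p.1) p.1), #B' = i + 1 → b p.1 ∈ B' →
        insert (u p) B' ∈ K \ X ∪ N := fun B' hB' hc hbB => by
      refine mem_union_left _ (mem_sdiff.2 ⟨hcl B' hB' hc, fun hmem => ?_⟩)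
      obtain ⟨p', hp', he'⟩ := mem_image.1 hmem
      refine disjoint_left.1 (mem_filter.1 hp').2.2 ?_ hbZ
      rw [he']
      exact mem_insert_of_mem hbB
    have hbC' := hbC _ hC
    by_cases hxu : x = u p
    · have hBC : B = insert p.2 p.1 := by
        rw [hBx, ← hEe, hxu]
        exact erase_insert (by rw [mem_insert, not_or]; exact ⟨huw, huC⟩)
      obtain ⟨e', he', hle⟩ := hQc p.1 hC p.2
        (mem_image.2 ⟨e, mem_filter.2 ⟨heX, rfl⟩, rfl⟩)
      exact ⟨e', mem_union_right _ (mem_biUnion.2 ⟨p.1, hC, he'⟩), hBC ▸ hle⟩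
    · -- The `(i + 1)`-set obtained from `{w} ∪ C` on replacing `x` by `b`.
      set B' := insert (b p.1) ((insert p.2 p.1).erase x)
      have hxm : x ∈ insert p.2 p.1 := by
        have : x ∈ E p := by rw [hEe, ← hxe]; exact mem_insert_self _ _
        exact (mem_insert.1 this).resolve_left hxu
      refine ⟨insert (u p) B', keep B' ?_ ?_ (mem_insert_self _ _), ?_⟩
      · intro y hy
        simp only [B', mem_insert, mem_erase] at hy ⊢
        tauto
      · rw [card_insert_of_notMem, card_erase_of_mem hxm, card_insert_of_notMem hwC, hCi _ hC]
        · rfl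
        · rw [mem_erase, mem_insert]
          rintro ⟨-, h | h⟩
          · exact hwb h.symm
          · exact hbC' h
      · rw [hBx, ← hEe]
        intro y hy
        simp only [B', E, mem_insert, mem_erase] at hy ⊢
        tauto
  refine ⟨#X, ?_, ?_⟩
  · have h1 := card_union_le (K \ X) N
    have h2 := card_sdiff_add_card_eq_card hXK
    omega
  · rw [← hpairs]
    exact hZ.trans (Nat.mul_le_mul_left _ hX)

/-! ### Stability: almost all edges meeting some core are present -/

/-- The vertices that complete `B` to an edge of `H`. -/
def completions {V : Type*} [Fintype V] [DecidableEq V] (H : Finset (Finset V)) (B : Finset V) :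
    Finset V :=
  univ.filter fun u => u ∉ B ∧ insert u B ∈ H

/-- The vertices that cover `A` in the `(j + 1)`-uniform hypergraph `H`. -/
def coverers {V : Type*} [Fintype V] [DecidableEq V] (j : ℕ) (H : Finset (Finset V))
    (A : Finset V) : Finset V :=
  univ.filter fun u => u ∉ A ∧ ∀ B ∈ A.powersetCard j, insert u B ∈ H

/-- The `j`-sets that form an edge of `H` together with the vertex `u`. -/
def link {V : Type*} [Fintype V] [DecidableEq V] (j : ℕ) (H : Finset (Finset V)) (u : V) :
    Finset (Finset V) :=
  (univ.powersetCard j).filter fun B => u ∈ completions H B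

section
variable {n : ℕ} {H : Finset (Finset (Fin n))}

theorem mem_completions {B : Finset (Fin n)} {u : Fin n} :
    u ∈ completions H B ↔ u ∉ B ∧ insert u B ∈ H := by
  simp [completions]

theorem sum_card_le_mul_card {r : ℕ} {E 𝓑 : Finset (Finset (Fin n))} (hE : ∀ e ∈ E, #e = r)
    {N : Finset (Fin n) → Finset (Fin n)}
    (hN : ∀ B ∈ 𝓑, ∀ u ∈ N B, u ∉ B ∧ insert u B ∈ E) : ∑ B ∈ 𝓑, #(N B) ≤ r * #E := by
  have h : #(E.sigma fun e => e) = #E * r := by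
    rw [card_sigma]
    exact sum_const_nat hE
  rw [mul_comm, ← h, ← card_sigma]
  refine card_le_card_of_injOn (fun p => ⟨insert p.2 p.1, p.2⟩) (fun p hp => ?_)
    fun p hp q hq hpq => ?_
  · obtain ⟨hB, hu⟩ := mem_sigma.1 hp
    exact mem_sigma.2 ⟨(hN _ hB _ hu).2, mem_insert_self _ _⟩
  · obtain ⟨B, u⟩ := p
    obtain ⟨B', u'⟩ := q
    obtain ⟨hB, hu⟩ := mem_sigma.1 hp
    obtain ⟨hB', hu'⟩ := mem_sigma.1 hq
    simp only [Sigma.mk.injEq, heq_eq_eq] at hpq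
    obtain ⟨h1, rfl⟩ := hpq
    have : B = B' := by
      have hu₁ : u ∉ B := (hN _ hB _ hu).1
      have hu₂ : u ∉ B' := (hN _ hB' _ hu').1
      rw [← erase_insert hu₁, ← erase_insert hu₂]
      exact congrArg (fun s => erase s u) h1
    rw [this]

theorem sum_card_link_le {j : ℕ} (hH : ∀ e ∈ H, #e = j + 1) :
    ∑ u, #(link j H u) ≤ (j + 1) * #H := by
  have h := sum_card_bipartiteAbove_eq_sum_card_bipartiteBelow (s := (univ : Finset (Fin n)))
    (t := univ.powersetCard j) (fun u B => u ∈ completions H B)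
  refine h.trans_le (sum_card_le_mul_card hH fun B _ u hu => ?_)
  exact mem_completions.1 (mem_filter.1 hu).2

/-- Edges with exactly one vertex in `U` and edges with none, counted by their `j`-subsets
outside `U`. -/
theorem sum_completions_le {j : ℕ} (hH : ∀ e ∈ H, #e = j + 1) (U : Finset (Fin n)) :
    ∑ B ∈ Uᶜ.powersetCard j, ((j + 1) * #(completions H B ∩ U) + #(completions H B \ U)) ≤
      (j + 1) * #H := by
  have h0 : ∑ B ∈ Uᶜ.powersetCard j, #(completions H B \ U) ≤
      (j + 1) * #{e ∈ H | Disjoint e U} := by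
    refine sum_card_le_mul_card (fun e he => hH e (mem_filter.1 he).1) fun B hB u hu => ?_
    obtain ⟨hu, huU⟩ := mem_sdiff.1 hu
    obtain ⟨huB, he⟩ := mem_completions.1 hu
    exact ⟨huB, mem_filter.2 ⟨he, disjoint_insert_left.2
      ⟨huU, subset_compl_iff_disjoint_right.1 (mem_powersetCard.1 hB).1⟩⟩⟩
  have h1 : ∑ B ∈ Uᶜ.powersetCard j, #(completions H B ∩ U) ≤ #{e ∈ H | ¬ Disjoint e U} := by
    rw [← card_sigma]
    have key : ∀ p ∈ (Uᶜ.powersetCard j).sigma fun B => completions H B ∩ U,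
        p.2 ∈ U ∧ Disjoint p.1 U ∧ p.2 ∉ p.1 ∧ insert p.2 p.1 ∈ H := fun p hp => by
      obtain ⟨hB, hu⟩ := mem_sigma.1 hp
      obtain ⟨hu, huU⟩ := mem_inter.1 hu
      exact ⟨huU, subset_compl_iff_disjoint_right.1 (mem_powersetCard.1 hB).1,
        mem_completions.1 hu⟩
    refine card_le_card_of_injOn (fun p => insert p.2 p.1) (fun p hp => ?_)
      fun p hp q hq hpq => ?_
    · obtain ⟨hU, -, -, he⟩ := key p hp
      exact mem_filter.2 ⟨he, fun h => disjoint_left.1 h (mem_insert_self _ _) hU⟩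
    · obtain ⟨hU, hd, -, -⟩ := key p hp
      obtain ⟨hU', hd', -, -⟩ := key q hq
      obtain ⟨B, u⟩ := p
      obtain ⟨B', u'⟩ := q
      have a1 := congrArg (fun s => s \ U) hpq
      have a2 := congrArg (fun s => s ∩ U) hpq
      simp only [insert_sdiff_of_mem _ hU, insert_sdiff_of_mem _ hU', sdiff_eq_self_of_disjoint hd,
        sdiff_eq_self_of_disjoint hd'] at a1
      simp only [insert_inter_of_mem hU, insert_inter_of_mem hU', disjoint_iff_inter_eq_empty.1 hd,
        disjoint_iff_inter_eq_empty.1 hd', insert_empty_eq, singleton_inj] at a2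
      rw [a1, a2]
  have h2 := card_filter_add_card_filter_not (s := H) (fun e => Disjoint e U)
  rw [sum_add_distrib, ← mul_sum]
  calc _ ≤ (j + 1) * #{e ∈ H | ¬ Disjoint e U} + (j + 1) * #{e ∈ H | Disjoint e U} :=
        Nat.add_le_add (Nat.mul_le_mul_left _ h1) h0
    _ = (j + 1) * #H := by rw [← h2]; ring

theorem EveryCovered.exists_notMem {j t : ℕ} (hH : EveryCovered (j + t) (j + 1) H)
    (hn : j + t ≤ n) {A : Finset (Fin n)} (hA : #A ≤ j + t) :
    ∃ u ∉ A, ∀ B ∈ A.powersetCard j, insert u B ∈ H := by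
  obtain ⟨A', hAA', -, hA'⟩ := exists_subsuperset_card_eq (subset_univ A) hA (by simpa using hn)
  obtain ⟨u, hu, hcov⟩ := hH.2 A' hA'
  exact ⟨u, fun h => hu (hAA' h), fun B hB => hcov B (powersetCard_mono hAA' hB)⟩

/-- Otherwise the set and its coverers would lie in a common `(j + t)`-set, whose coverer would be
a further one. -/
theorem EveryCovered.le_card_coverers {j t : ℕ} (hH : EveryCovered (j + t) (j + 1) H)
    (hn : j + t ≤ n) {A : Finset (Fin n)} (hA : #A = j + 1) : t ≤ #(coverers j H A) := by
  by_contra! h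
  obtain ⟨u, hu, hcov⟩ := hH.exists_notMem hn (A := A ∪ coverers j H A)
    ((card_union_le _ _).trans (by omega))
  rw [mem_union, not_or] at hu
  exact hu.2 (mem_filter.2 ⟨mem_univ _, hu.1,
    fun B hB => hcov B (powersetCard_mono subset_union_left hB)⟩)

theorem EveryCovered.completions_sdiff_nonempty {j t : ℕ} (hH : EveryCovered (j + t) (j + 1) H)
    (hn : j + t ≤ n) {B U : Finset (Fin n)} (hB : #B = j) (hw : #(completions H B ∩ U) ≤ t) :
    (completions H B \ U).Nonempty := by
  obtain ⟨u, hu, hcov⟩ := hH.exists_notMem hn (A := B ∪ completions H B ∩ U)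
    ((card_union_le _ _).trans (by omega))
  rw [mem_union, not_or, mem_inter, not_and] at hu
  have := mem_completions.2 ⟨hu.1, hcov B (mem_powersetCard.2 ⟨subset_union_left, hB⟩)⟩
  exact ⟨u, mem_sdiff.2 ⟨this, hu.2 this⟩⟩

theorem coverers_subset_completions {j : ℕ} {A B : Finset (Fin n)} (hB : B ∈ A.powersetCard j) :
    coverers j H A ⊆ completions H B := fun u hu => by
  obtain ⟨-, huA, h⟩ := mem_filter.1 hu
  exact mem_completions.2 ⟨fun h' => huA ((mem_powersetCard.1 hB).1 h'), h B hB⟩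

/-- The `(j + 1)`-sets covered by some vertex outside `U`. -/
def coveredOutside {n : ℕ} (j : ℕ) (H : Finset (Finset (Fin n))) (U : Finset (Fin n)) :
    Finset (Finset (Fin n)) :=
  (univ.powersetCard (j + 1)).filter fun A => ¬ coverers j H A ⊆ U

theorem EveryCovered.le_card_completions_inter {j t : ℕ} (hH : EveryCovered (j + t) (j + 1) H)
    (hn : j + t ≤ n) {A B U : Finset (Fin n)} (hA : #A = j + 1) (hAU : A ∉ coveredOutside j H U)
    (hB : B ∈ A.powersetCard j) : t ≤ #(completions H B ∩ U) := by
  have hsub : coverers j H A ⊆ U := by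
    by_contra h
    exact hAU (mem_filter.2 ⟨mem_powersetCard.2 ⟨subset_univ _, hA⟩, h⟩)
  exact (hH.le_card_coverers hn hA).trans
    (card_le_card (subset_inter (coverers_subset_completions hB) hsub))

/-- The `j`-sets with too few completions in `U` have all their `(j + 1)`-supersets covered by
vertices outside `U`. -/
theorem EveryCovered.card_deficient_mul_le {j t : ℕ} (hH : EveryCovered (j + t) (j + 1) H)
    (hn : j + t ≤ n) (U : Finset (Fin n)) :
    #{B ∈ univ.powersetCard j | #(completions H B ∩ U) < t} * (n - j) ≤
      #(coveredOutside j H U) * (j + 1) := by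
  refine card_mul_le_card_mul (fun B A => B ⊆ A) (fun B hB => ?_) fun A hA => ?_
  · obtain ⟨hB, hlt⟩ := mem_filter.1 hB
    have hBj := (mem_powersetCard.1 hB).2
    have hc : #(Bᶜ.image fun u => insert u B) = n - j := by
      rw [card_image_of_injOn, card_compl, hBj, Fintype.card_fin]
      intro u hu v hv huv
      have hu' : u ∉ B := by simpa using hu
      have : u ∈ insert v B := by
        have h : insert u B = insert v B := huv
        rw [← h]
        exact mem_insert_self _ _
      exact (mem_insert.1 this).resolve_right hu'
    rw [← hc]
    refine card_le_card fun A hA => ?_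
    obtain ⟨u, hu, rfl⟩ := mem_image.1 hA
    have hAc : #(insert u B) = j + 1 := by rw [card_insert_of_notMem (by simpa using hu), hBj]
    refine mem_filter.2 ⟨?_, subset_insert _ _⟩
    by_contra h
    exact hlt.not_ge (hH.le_card_completions_inter hn hAc h
      (mem_powersetCard.2 ⟨subset_insert _ _, hBj⟩))
  · have hAc := (mem_powersetCard.1 (mem_filter.1 hA).1).2
    calc _ ≤ #(A.powersetCard j) := card_le_card fun B hB => by
          obtain ⟨hB, hBA⟩ := mem_filter.1 hB
          exact mem_powersetCard.2 ⟨hBA, (mem_powersetCard.1 (mem_filter.1 hB).1).2⟩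
      _ = j + 1 := by rw [card_powersetCard, hAc, Nat.choose_succ_self_right]

/-- A `j`-set outside `U` with at most `t` completions in `U` has a completion outside `U`, and so
contributes at least `(j + 1) t + 1` to the count of edges unless it has fewer than `t` completions
in `U`; if it has more than `t` then it contributes more than that. -/
theorem EveryCovered.card_excessive_le {i t : ℕ} (hH : EveryCovered (i + 1 + t) (i + 2) H)
    (hn : i + 1 + t ≤ n) (U : Finset (Fin n)) :
    ((i + 2) * t + 1) * (n - #U).choose (i + 1) +
      #{B ∈ Uᶜ.powersetCard (i + 1) | t < #(completions H B ∩ U)} ≤ (i + 2) * #H +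
      ((i + 2) * t + 1) * #{B ∈ univ.powersetCard (i + 1) | #(completions H B ∩ U) < t} := by
  have hsum : ∑ B ∈ Uᶜ.powersetCard (i + 1),
      ((i + 2) * #(completions H B ∩ U) + #(completions H B \ U)) ≤ (i + 2) * #H :=
    sum_completions_le hH.1 U
  have hpt : ∀ B ∈ Uᶜ.powersetCard (i + 1), ((i + 2) * t + 1) +
      (if t < #(completions H B ∩ U) then 1 else 0) ≤
      ((i + 2) * #(completions H B ∩ U) + #(completions H B \ U)) +
      ((i + 2) * t + 1) * (if #(completions H B ∩ U) < t then 1 else 0) := by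
    intro B hB
    rcases lt_trichotomy (#(completions H B ∩ U)) t with h | h | h
    · rw [if_pos h, if_neg h.le.not_gt]
      omega
    · have := (hH.completions_sdiff_nonempty hn (mem_powersetCard.1 hB).2 h.le).card_pos
      rw [h, if_neg (lt_irrefl t)]
      omega
    · rw [if_pos h, if_neg h.le.not_gt]
      have : (i + 2) * (t + 1) ≤ (i + 2) * #(completions H B ∩ U) :=
        Nat.mul_le_mul_left _ h
      have h2 : (i + 2) * (t + 1) = (i + 2) * t + i + 2 := by ring
      omega
  generalize (i + 2) * t + 1 = c at hpt ⊢
  have h := sum_le_sum hpt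
  rw [sum_add_distrib, sum_add_distrib, sum_const, card_powersetCard, card_compl, Fintype.card_fin,
    ← mul_sum, ← card_filter, ← card_filter, smul_eq_mul, mul_comm] at h
  have h2 : #{B ∈ Uᶜ.powersetCard (i + 1) | #(completions H B ∩ U) < t} ≤
      #{B ∈ univ.powersetCard (i + 1) | #(completions H B ∩ U) < t} :=
    card_le_card (filter_subset_filter _ (powersetCard_mono (subset_univ _)))
  have h3 := Nat.mul_le_mul_left c h2
  omega

theorem card_not_tight_le {i t : ℕ} (U : Finset (Fin n)) :
    #{B ∈ univ.powersetCard (i + 1) | #(completions H B ∩ U) ≠ t} ≤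
      #{B ∈ univ.powersetCard (i + 1) | #(completions H B ∩ U) < t} +
      #{B ∈ Uᶜ.powersetCard (i + 1) | t < #(completions H B ∩ U)} + #U * n ^ i := by
  have hU : #{B ∈ univ.powersetCard (i + 1) | ¬ Disjoint B U} ≤ #U * n ^ i := by
    have hUn : #U ≤ n := by simpa using card_le_univ U
    rw [card_filter_not_disjoint]
    have := choose_succ_le_choose_add (Nat.sub_le n #U) i
    rw [Nat.sub_sub_self hUn] at this
    omega
  refine le_trans (card_le_card (t := _ ∪ _ ∪ _) fun B hB => ?_)
    ((card_union_le _ _).trans (Nat.add_le_add (card_union_le _ _) hU))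
  obtain ⟨hB, hne⟩ := mem_filter.1 hB
  simp only [mem_union, mem_filter, hB, true_and, mem_powersetCard,
    subset_compl_iff_disjoint_right, (mem_powersetCard.1 hB).2, and_true]
  by_cases hd : Disjoint B U
  · rcases lt_or_gt_of_ne hne with h | h
    · exact Or.inl (Or.inl h)
    · exact Or.inl (Or.inr ⟨hd, h⟩)
  · exact Or.inr hd

theorem choose_le_card_fine_add {j t : ℕ} (U : Finset (Fin n)) :
    n.choose (j + 1) ≤ #{A ∈ univ.powersetCard (j + 1) | A ∉ coveredOutside j H U ∧
        ∀ B ∈ A.powersetCard j, #(completions H B ∩ U) = t} +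
      (#(coveredOutside j H U) + n * #{B ∈ univ.powersetCard j | #(completions H B ∩ U) ≠ t}) := by
  set 𝒩 := {B ∈ (univ : Finset (Fin n)).powersetCard j | #(completions H B ∩ U) ≠ t}
  have h1 : #((univ ×ˢ 𝒩).image fun p : Fin n × Finset (Fin n) => insert p.1 p.2) ≤ n * #𝒩 :=
    card_image_le.trans (by rw [card_product, card_univ, Fintype.card_fin])
  have h2 : #((univ : Finset (Fin n)).powersetCard (j + 1)) = n.choose (j + 1) := by simp
  rw [← h2]
  refine le_trans (card_le_card (t := _ ∪ (_ ∪ _)) fun A hA => ?_)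
    ((card_union_le _ _).trans (Nat.add_le_add_left
      ((card_union_le _ _).trans (Nat.add_le_add_left h1 _)) _))
  rw [mem_union, mem_union]
  by_cases hAU : A ∈ coveredOutside j H U
  · exact Or.inr (Or.inl hAU)
  by_cases h : ∀ B ∈ A.powersetCard j, #(completions H B ∩ U) = t
  · exact Or.inl (mem_filter.2 ⟨hA, hAU, h⟩)
  push Not at h
  obtain ⟨B, hB, hne⟩ := h
  obtain ⟨hBA, hBj⟩ := mem_powersetCard.1 hB
  obtain ⟨x, -, hx⟩ := (exists_eq_insert_iff (s := B) (t := A)).2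
    ⟨hBA, by rw [hBj, (mem_powersetCard.1 hA).2]⟩
  exact Or.inr (Or.inr (mem_image.2 ⟨(x, B), mem_product.2 ⟨mem_univ _, mem_filter.2
    ⟨mem_powersetCard.2 ⟨subset_univ _, hBj⟩, hne⟩⟩, hx⟩))

theorem card_missing_le {j : ℕ} (U T : Finset (Fin n)) :
    #{e ∈ univ.powersetCard (j + 1) | ¬ Disjoint e T ∧ e ∉ H} ≤
      #T * #{B ∈ univ.powersetCard j | completions H B ∩ U ≠ T} := by
  rw [← card_product]
  refine (card_le_card fun e he => ?_).trans
    (card_image_le (f := fun p : Fin n × Finset (Fin n) => insert p.1 p.2))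
  obtain ⟨hec, hd, heH⟩ := mem_filter.1 he
  obtain ⟨v, hve, hvT⟩ := not_disjoint_iff.1 hd
  refine mem_image.2 ⟨(v, e.erase v), mem_product.2 ⟨hvT, mem_filter.2 ⟨mem_powersetCard.2
    ⟨subset_univ _, ?_⟩, fun h => ?_⟩⟩, insert_erase hve⟩
  · rw [card_erase_of_mem hve, (mem_powersetCard.1 hec).2]
    rfl
  · rw [← h] at hvT
    have := (mem_completions.1 (mem_inter.1 hvT).1).2
    rw [insert_erase hve] at this
    exact heH this

/-- If the links of the vertices outside `U` are sparse then they contain few complete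
`(j + 1)`-sets, by the Kruskal–Katona theorem. -/
theorem card_coveredOutside_le {j : ℕ} (hH : ∀ e ∈ H, #e = j + 1) {ε : ℝ}
    {U : Finset (Fin n)} (hε : 0 ≤ ε)
    (hU : ∀ u ∉ U, ∀ 𝒜 : Finset (Finset (Fin n)), (𝒜 : Set (Finset (Fin n))).Sized (j + 1) →
      ∂ 𝒜 ⊆ link j H u → (#𝒜 : ℝ) ≤ ε * n * #(∂ 𝒜)) :
    (#(coveredOutside j H U) : ℝ) ≤ ε * n * ((j + 1) * #H) := by
  set 𝒜 : Fin n → Finset (Finset (Fin n)) := fun u =>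
    (univ.powersetCard (j + 1)).filter fun A => u ∈ coverers j H A
  have h1 : coveredOutside j H U ⊆ Uᶜ.biUnion 𝒜 := fun A hA => by
    obtain ⟨hA, hc⟩ := mem_filter.1 hA
    obtain ⟨u, hu, huU⟩ := not_subset.1 hc
    exact mem_biUnion.2 ⟨u, mem_compl.2 huU, mem_filter.2 ⟨hA, hu⟩⟩
  have h2 : ∀ u ∈ Uᶜ, (#(𝒜 u) : ℝ) ≤ ε * n * #(link j H u) := fun u hu => by
    have hsub : ∂ (𝒜 u) ⊆ link j H u := fun B hB => by
      obtain ⟨A, hA, a, ha, rfl⟩ := mem_shadow_iff.1 hB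
      obtain ⟨hAc, huA⟩ := mem_filter.1 hA
      have hBj : #(A.erase a) = j := by
        rw [card_erase_of_mem ha, (mem_powersetCard.1 hAc).2]
        rfl
      exact mem_filter.2 ⟨mem_powersetCard.2 ⟨subset_univ _, hBj⟩,
        coverers_subset_completions (mem_powersetCard.2 ⟨erase_subset _ _, hBj⟩) huA⟩
    refine (hU u (mem_compl.1 hu) (𝒜 u)
      (fun A hA => (mem_powersetCard.1 (mem_filter.1 hA).1).2) hsub).trans ?_
    have : (#(∂ (𝒜 u)) : ℝ) ≤ #(link j H u) := by exact_mod_cast card_le_card hsub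
    gcongr
  have h3 : (∑ u, (#(link j H u) : ℝ)) ≤ (j + 1) * #H := by exact_mod_cast sum_card_link_le hH
  calc (#(coveredOutside j H U) : ℝ) ≤ ∑ u ∈ Uᶜ, (#(𝒜 u) : ℝ) := by
        exact_mod_cast (card_le_card h1).trans card_biUnion_le
    _ ≤ ∑ u ∈ Uᶜ, ε * n * #(link j H u) := sum_le_sum h2
    _ ≤ ∑ u, ε * n * #(link j H u) :=
      sum_le_sum_of_subset_of_nonneg (subset_univ _) fun _ _ _ => by positivity
    _ = ε * n * ∑ u, (#(link j H u) : ℝ) := by rw [mul_sum]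
    _ ≤ _ := by gcongr

theorem mul_g_le {i t : ℕ} (hn : i + 1 + t < n) :
    (i + 2) * g n (i + 1 + t) (i + 2) ≤
      ((i + 2) * t + 1) * n.choose (i + 1) + (i + 2) * (i + 1) * n ^ i := by
  have h1 := choose_succ_le_choose_add_mul_choose (Nat.sub_le n t) (i + 1)
  rw [Nat.sub_sub_self (by omega)] at h1
  have h2 : n.choose (i + 2) - (n - t).choose (i + 2) ≤ t * n.choose (i + 1) := by
    rw [tsub_le_iff_left]
    exact h1
  have h3 := mul_D_le (m := n - t) (i := i) (by omega)
  have h4 : (n - t).choose (i + 1) ≤ n.choose (i + 1) := Nat.choose_le_choose _ (Nat.sub_le _ _)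
  have h5 : (n - t) ^ i ≤ n ^ i := Nat.pow_le_pow_left (Nat.sub_le _ _) _
  rw [g_eq n (i + 1) t]
  calc _ = (i + 2) * (n.choose (i + 2) - (n - t).choose (i + 2)) +
        (i + 2) * D (n - t) (i + 2) := mul_add _ _ _
    _ ≤ (i + 2) * (t * n.choose (i + 1)) +
        (n.choose (i + 1) + (i + 2) * ((i + 1) * n ^ i)) :=
      Nat.add_le_add (Nat.mul_le_mul_left _ h2) (h3.trans (Nat.add_le_add h4
        (Nat.mul_le_mul_left _ (Nat.mul_le_mul_left _ h5))))
    _ = _ := by ring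

end

section
variable {n : ℕ} {H : Finset (Finset (Fin n))}

/-- An optimal hypergraph contains almost all the edges that meet a suitable `t`-set. Take for `U`
the vertices of large degree, which are boundedly many. Almost all `(i + 1)`-sets have exactly `t`
completions in `U`, and for almost all `(i + 2)`-sets the same `t` vertices of `U` complete each of
their `(i + 1)`-subsets. So the set of completions in `U` is almost constant. -/
theorem exists_almost_core (i t : ℕ) {δ : ℝ} (hδ : 0 < δ) :
    ∃ n₀ : ℕ, ∀ n ≥ n₀, ∀ H : Finset (Finset (Fin n)), EveryCovered (i + 1 + t) (i + 2) H →
      #H ≤ g n (i + 1 + t) (i + 2) → ∃ T : Finset (Fin n), #T = t ∧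
        (#{e ∈ univ.powersetCard (i + 2) | ¬ Disjoint e T ∧ e ∉ H} : ℝ) ≤ δ * n ^ (i + 1) := by
  obtain ⟨ε, hε, n₁, hn₁⟩ := exists_dominant_colour i (δ := min 1 (δ / (t + 1)))
    (by positivity) (min_le_left _ _)
  -- `c` is `r t + 1` with `r = i + 2`, and `κ * n ^ (i + 1)` bounds the sum of the degrees.
  obtain ⟨c, hc⟩ : ∃ c : ℝ, c = (i + 2) * t + 1 := ⟨_, rfl⟩
  obtain ⟨κ, hκ⟩ : ∃ κ : ℝ, κ = c + (i + 2) * (i + 1) := ⟨_, rfl⟩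
  have hc0 : 0 < c := by rw [hc]; positivity
  have hκ0 : 0 < κ := by rw [hκ]; positivity
  obtain ⟨ε₁, hε₁⟩ : ∃ ε₁ : ℝ, ε₁ = ε / (2 * (κ * (1 + 2 * (i + 2) * (c + 1)))) := ⟨_, rfl⟩
  have hε₁0 : 0 < ε₁ := by rw [hε₁]; positivity
  obtain ⟨δ₁, hδ₁, n₂, hn₂⟩ := exists_card_le_mul_card_shadow (i + 1) hε₁0
  obtain ⟨L, hL⟩ : ∃ L : ℝ, L = (c + 1) * (κ / δ₁) + (i + 2) * (i + 1) := ⟨_, rfl⟩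
  refine ⟨n₁ + n₂ + 2 * (i + 1 + t) + 1 + ⌈2 * L / ε⌉₊, fun n hn H hH hg => ?_⟩
  have hnL : 2 * L / ε ≤ n := (Nat.le_ceil _).trans (by exact_mod_cast (by omega))
  have hn0 : (0 : ℝ) < n := by exact_mod_cast (by omega : 0 < n)
  set N : ℝ := (n : ℝ) ^ i with hN
  have hN0 : 0 < N := by positivity
  have hN1 : (n : ℝ) ^ (i + 1) = n * N := by rw [hN]; ring
  have hN2 : (n : ℝ) ^ (i + 2) = n * (n * N) := by rw [hN]; ring
  have hchoose : (n.choose (i + 1) : ℝ) ≤ n * N := by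
    rw [← hN1]
    exact_mod_cast Nat.choose_le_pow _ _
  have hHc : ((i : ℝ) + 2) * #H ≤ c * n.choose (i + 1) + (i + 2) * (i + 1) * N := by
    have h := (Nat.mul_le_mul_left (i + 2) hg).trans (mul_g_le (by omega))
    rw [hc, hN]
    exact_mod_cast h
  have hN1N : N ≤ n * N := le_mul_of_one_le_left hN0.le (by exact_mod_cast (by omega : 1 ≤ n))
  have hHκ : ((i : ℝ) + 2) * #H ≤ κ * (n * N) := by
    have h1 : c * n.choose (i + 1) ≤ c * (n * N) := by gcongr
    have h2 : ((i : ℝ) + 2) * (i + 1) * N ≤ (i + 2) * (i + 1) * (n * N) := by gcongr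
    rw [hκ, add_mul]
    linarith
  set U : Finset (Fin n) := univ.filter fun u => δ₁ * (n * N) < #(link (i + 1) H u) with hU
  have hUc : (#U : ℝ) ≤ κ / δ₁ := by
    have h1 : (#U : ℝ) * (δ₁ * (n * N)) ≤ ((i : ℝ) + 2) * #H := by
      calc (#U : ℝ) * (δ₁ * (n * N)) = ∑ u ∈ U, δ₁ * (n * N) := by
            rw [sum_const, nsmul_eq_mul]
        _ ≤ ∑ u ∈ U, (#(link (i + 1) H u) : ℝ) :=
          sum_le_sum fun u hu => (mem_filter.1 hu).2.le
        _ ≤ ∑ u, (#(link (i + 1) H u) : ℝ) :=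
          sum_le_sum_of_subset_of_nonneg (subset_univ _) fun _ _ _ => by positivity
        _ ≤ _ := by exact_mod_cast sum_card_link_le hH.1
    rw [le_div_iff₀ hδ₁]
    have h2 : (#U * δ₁) * (n * N) ≤ κ * (n * N) := by linarith
    exact le_of_mul_le_mul_right h2 (by positivity)
  set 𝒬 := coveredOutside (i + 1) H U
  have hQ : (#𝒬 : ℝ) ≤ ε₁ * n * (κ * (n * N)) := by
    have h := card_coveredOutside_le (ε := ε₁) (U := U) hH.1 hε₁0.le fun u hu 𝒜 h𝒜 hsub => by
      refine hn₂ n (by omega) 𝒜 h𝒜 ?_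
      have h1 : (#(∂ 𝒜) : ℝ) ≤ #(link (i + 1) H u) := by exact_mod_cast card_le_card hsub
      have h2 : (#(link (i + 1) H u) : ℝ) ≤ δ₁ * (n * N) := by
        simpa [hU] using hu
      rw [hN1]
      linarith
    refine h.trans ?_
    have : (((i + 1 : ℕ) : ℝ) + 1) * #H = (i + 2) * #H := by push_cast; ring
    rw [this]
    gcongr
  set 𝒟 := {B ∈ (univ : Finset (Fin n)).powersetCard (i + 1) | #(completions H B ∩ U) < t}
  have hD : (#𝒟 : ℝ) ≤ 2 * (i + 2) * ε₁ * (κ * (n * N)) := by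
    have h := hH.card_deficient_mul_le (by omega) U
    have h1 : (#𝒟 : ℝ) * ((n - (i + 1) : ℕ) : ℝ) ≤ #𝒬 * (((i + 1 : ℕ) : ℝ) + 1) := by
      exact_mod_cast h
    have h2 : (n : ℝ) / 2 ≤ ((n - (i + 1) : ℕ) : ℝ) := by
      have : n ≤ 2 * (n - (i + 1)) := by omega
      have : (n : ℝ) ≤ 2 * ((n - (i + 1) : ℕ) : ℝ) := by exact_mod_cast this
      linarith
    have h3 : (#𝒟 : ℝ) * (n / 2) ≤ (ε₁ * n * (κ * (n * N))) * (i + 2) := by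
      calc (#𝒟 : ℝ) * (n / 2) ≤ #𝒟 * ((n - (i + 1) : ℕ) : ℝ) := by gcongr
        _ ≤ #𝒬 * (((i + 1 : ℕ) : ℝ) + 1) := h1
        _ = #𝒬 * (i + 2) := by push_cast; ring
        _ ≤ _ := by gcongr
    refine le_of_mul_le_mul_right (h3.trans_eq ?_) (show (0 : ℝ) < n / 2 by positivity)
    ring
  set 𝒪 := {B ∈ Uᶜ.powersetCard (i + 1) | t < #(completions H B ∩ U)}
  have hO : (#𝒪 : ℝ) ≤ c * (#U * N) + (i + 2) * (i + 1) * N + c * #𝒟 := by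
    have h := hH.card_excessive_le (by omega) U
    have h1 : c * (n - #U).choose (i + 1) + #𝒪 ≤ ((i : ℝ) + 2) * #H + c * #𝒟 := by
      rw [hc]
      exact_mod_cast h
    have hUn : #U ≤ n := by simpa using card_le_univ U
    have h2 := choose_succ_le_choose_add (Nat.sub_le n #U) i
    rw [Nat.sub_sub_self hUn] at h2
    have h3 : (n.choose (i + 1) : ℝ) ≤ (n - #U).choose (i + 1) + #U * N := by
      rw [hN]
      exact_mod_cast h2
    have h4 : c * n.choose (i + 1) ≤ c * ((n - #U).choose (i + 1) + #U * N) := by gcongr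
    rw [mul_add] at h4
    linarith
  set 𝒩 := {B ∈ (univ : Finset (Fin n)).powersetCard (i + 1) | #(completions H B ∩ U) ≠ t}
  have hNT : (#𝒩 : ℝ) ≤ #𝒟 + #𝒪 + #U * N := by
    rw [hN]
    exact_mod_cast card_not_tight_le U
  have hNb : (#𝒩 : ℝ) ≤ (c + 1) * (2 * (i + 2) * ε₁ * (κ * (n * N))) + L * N := by
    have h1 : (c + 1) * #𝒟 ≤ (c + 1) * (2 * (i + 2) * ε₁ * (κ * (n * N))) := by gcongr
    have h2 : (c + 1) * (#U * N) ≤ (c + 1) * (κ / δ₁ * N) := by gcongr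
    have h3 : L * N = (c + 1) * (κ / δ₁ * N) + (i + 2) * (i + 1) * N := by rw [hL]; ring
    linarith
  set F := {A ∈ (univ : Finset (Fin n)).powersetCard (i + 1 + 1) | A ∉ 𝒬 ∧
    ∀ B ∈ A.powersetCard (i + 1), #(completions H B ∩ U) = t}
  have hFc : (n.choose (i + 2) : ℝ) ≤ #F + ε * n ^ (i + 2) := by
    have h : (n.choose (i + 2) : ℝ) ≤ #F + (#𝒬 + n * #𝒩) := by
      exact_mod_cast choose_le_card_fine_add (H := H) (j := i + 1) (t := t) U
    have h1 : n * (#𝒩 : ℝ) ≤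
        n * ((c + 1) * (2 * (i + 2) * ε₁ * (κ * (n * N))) + L * N) := by gcongr
    have h2 : ε₁ * n * (κ * (n * N)) + n * ((c + 1) * (2 * (i + 2) * ε₁ * (κ * (n * N)))) =
        ε / 2 * (n * (n * N)) := by
      rw [hε₁]
      field_simp
    have h3 : n * (L * N) ≤ ε / 2 * (n * (n * N)) := by
      have : L ≤ ε / 2 * n := by
        rw [div_le_iff₀ hε] at hnL
        linarith
      calc n * (L * N) ≤ n * (ε / 2 * n * N) := by gcongr
        _ = _ := by ring
    rw [hN2]
    linarith
  have hcov : ∀ A ∈ F, ∀ B ∈ A.powersetCard (i + 1),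
      completions H B ∩ U = coverers (i + 1) H A := fun A hA B hB => by
    obtain ⟨hA, hAQ, hAt⟩ := mem_filter.1 hA
    have hAc := (mem_powersetCard.1 hA).2
    have hsub : coverers (i + 1) H A ⊆ U := by
      by_contra h
      exact hAQ (mem_filter.2 ⟨hA, h⟩)
    refine (eq_of_subset_of_card_le (subset_inter (coverers_subset_completions hB) hsub) ?_).symm
    rw [hAt B hB]
    exact hH.le_card_coverers (by omega) hAc
  obtain ⟨A, hA, B, hB, hAB⟩ := hn₁ n (by omega) (fun B => completions H B ∩ U) F
    (fun A hA => (mem_powersetCard.1 (mem_filter.1 hA).1).2)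
    (fun A hA B hB B' hB' => (hcov A hA B hB).trans (hcov A hA B' hB').symm) hFc
  have hT := (mem_filter.1 hA).2.2 B hB
  refine ⟨completions H B ∩ U, hT, ?_⟩
  have h := card_missing_le (j := i + 1) (H := H) U (completions H B ∩ U)
  rw [hT] at h
  have h1 : (#{e ∈ (univ : Finset (Fin n)).powersetCard (i + 2) |
      ¬ Disjoint e (completions H B ∩ U) ∧ e ∉ H} : ℝ) ≤
      t * #{B' ∈ univ.powersetCard (i + 1) | completions H B' ∩ U ≠ completions H B ∩ U} := by
    exact_mod_cast h
  refine h1.trans ?_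
  calc _ ≤ t * (min 1 (δ / (t + 1)) * (n : ℝ) ^ (i + 1)) := by gcongr
    _ ≤ t * (δ / (t + 1) * (n : ℝ) ^ (i + 1)) := by
      gcongr
      exact min_le_right _ _
    _ = t / (t + 1) * (δ * (n : ℝ) ^ (i + 1)) := by ring
    _ ≤ 1 * (δ * (n : ℝ) ^ (i + 1)) := by
      gcongr
      rw [div_le_one (by positivity)]
      linarith
    _ = _ := one_mul _

/-! ### From almost all edges to all edges -/

/-- Suppose that the missing edge `e` meets the core `T` in `v`, and let `B` be an `(i + 1)`-set
outside `T` containing `e \ T`. Then for every `w` the vertex covering `(T \ {v}) ∪ B ∪ {w}` lies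
outside `T`, so `B` is bad for the trace of `H` outside `T`. -/
theorem EveryCovered.exists_cover_outside {i t : ℕ} (hH : EveryCovered (i + 1 + t) (i + 2) H)
    {T B e : Finset (Fin n)} (hT : #T = t) (hB : #B = i + 1) (hBT : Disjoint B T)
    (he : #e = i + 2) (heT : ¬ Disjoint e T) (heH : e ∉ H) (heB : e \ T ⊆ B) {w : Fin n}
    (hwT : w ∉ T) (hwB : w ∉ B) :
    ∃ u ∈ Tᶜ, u ∉ B ∧ u ≠ w ∧ ∀ B' ⊆ insert w B, #B' = i + 1 →
      insert u B' ∈ {e ∈ H | Disjoint e T} := by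
  obtain ⟨v, hve, hvT⟩ := not_disjoint_iff.1 heT
  have hwBT : Disjoint (insert w B) T := disjoint_insert_left.2 ⟨hwT, hBT⟩
  obtain ⟨u, huA, hu⟩ := hH.2 (insert w B ∪ T.erase v) (by
    rw [card_union_of_disjoint (hwBT.mono_right (erase_subset _ _)), card_insert_of_notMem hwB, hB,
      card_erase_of_mem hvT, hT]
    have := card_pos.2 ⟨v, hvT⟩
    omega)
  simp only [mem_union, mem_insert, mem_erase, not_or, not_and] at huA
  have huT : u ∉ T := fun huT => by
    have huv : u = v := by
      by_contra h
      exact huA.2 h huT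
    subst huv
    refine heH ?_
    rw [← insert_erase hve]
    refine hu _ (mem_powersetCard.2 ⟨fun x hx => ?_, by rw [card_erase_of_mem hve, he]⟩)
    obtain ⟨hxu, hxe⟩ := mem_erase.1 hx
    by_cases hxT : x ∈ T
    · exact mem_union_right _ (mem_erase.2 ⟨hxu, hxT⟩)
    · exact mem_union_left _ (mem_insert_of_mem (heB (mem_sdiff.2 ⟨hxe, hxT⟩)))
  refine ⟨u, mem_compl.2 huT, huA.1.2, huA.1.1, fun B' hB' hc => mem_filter.2
    ⟨hu B' (mem_powersetCard.2 ⟨hB'.trans subset_union_left, hc⟩), ?_⟩⟩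
  exact disjoint_insert_left.2 ⟨huT, hwBT.mono_left hB'⟩

/-- An optimal hypergraph contains all edges that meet a suitable `t`-set. -/
theorem exists_core (i t : ℕ) :
    ∃ n₀ : ℕ, ∀ n ≥ n₀, ∀ H : Finset (Finset (Fin n)), EveryCovered (i + 1 + t) (i + 2) H →
      #H ≤ g n (i + 1 + t) (i + 2) → ∃ T : Finset (Fin n), #T = t ∧
        ∀ e : Finset (Fin n), #e = i + 2 → ¬ Disjoint e T → e ∈ H := by
  -- `1 / Q` is the proportion of the cases that can be treated in `exists_saving`.
  obtain ⟨Q, hQ⟩ : ∃ Q : ℕ, Q = 2 ^ (i + 3) * (i + 2) ^ 2 := ⟨_, rfl⟩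
  have hQ0 : 0 < Q := by rw [hQ]; positivity
  obtain ⟨δ, hδ, n₁, hn₁⟩ := exists_card_le_mul_card_shadow i
    (ε := 1 / (8 * Q * 2 ^ (i + 1 + t))) (by positivity)
  obtain ⟨n₂, hn₂⟩ := exists_almost_core i t (δ := δ / (4 * Q)) (by positivity)
  refine ⟨n₁ + n₂ + 2 * (Q + (i + 1) + t) + 1, fun n hn H hH hg => ?_⟩
  obtain ⟨T, hT, hM⟩ := hn₂ n (by omega) H hH hg
  refine ⟨T, hT, ?_⟩
  set M := {e ∈ (univ : Finset (Fin n)).powersetCard (i + 2) | ¬ Disjoint e T ∧ e ∉ H}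
  set K := {e ∈ H | Disjoint e T}
  set P := {B ∈ Tᶜ.powersetCard (i + 1) | ∃ e ∈ M, e \ T ⊆ B}
  have hTc : #Tᶜ = n - t := by rw [card_compl, Fintype.card_fin, hT]
  have hKM : #K ≤ D (n - t) (i + 2) + #M := by
    have h := card_add_card_missing hH.1 T
    rw [hT] at h
    change #H + #M = n.choose (i + 2) - (n - t).choose (i + 2) + #K at h
    rw [g_eq n (i + 1) t] at hg
    change #H ≤ n.choose (i + 2) - (n - t).choose (i + 2) + D (n - t) (i + 2) at hg
    omega
  obtain ⟨q, hq1, hq2⟩ := exists_saving (W := Tᶜ) (K := K) (P := P) hTc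
    (fun e he => ⟨subset_compl_iff_disjoint_right.2 (mem_filter.1 he).2,
      hH.1 e (mem_filter.1 he).1⟩)
    (fun B hB hBj => hH.exists_disjoint_superset hT hBj (subset_compl_iff_disjoint_right.1 hB))
    (fun B hB => mem_powersetCard.1 (mem_filter.1 hB).1)
    (fun B hB w hw hwB => by
      obtain ⟨hB, e, he, heB⟩ := mem_filter.1 hB
      obtain ⟨hBT, hBc⟩ := mem_powersetCard.1 hB
      obtain ⟨hec, heT, heH⟩ := mem_filter.1 he
      exact hH.exists_cover_outside hT hBc (subset_compl_iff_disjoint_right.1 hBT)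
        (mem_powersetCard.1 hec).2 heT heH heB (mem_compl.1 hw) hwB)
  rw [← mul_assoc, ← hQ] at hq2
  -- Each bad set accounts for boundedly many missing edges.
  have hMP : #M ≤ #P * 2 ^ (i + 1 + t) := by
    refine (card_le_card (t := P.biUnion fun B => (B ∪ T).powerset) fun e he => ?_).trans
      (card_biUnion_le_card_mul _ _ _ fun B hB => ?_)
    · obtain ⟨hec, heT, heH⟩ := mem_filter.1 he
      obtain ⟨v, hve, hvT⟩ := not_disjoint_iff.1 heT
      have hle : #(e \ T) ≤ i + 1 := by
        have h1 : e \ T ⊆ e.erase v := fun x hx => mem_erase.2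
          ⟨fun h => (mem_sdiff.1 hx).2 (h ▸ hvT), (mem_sdiff.1 hx).1⟩
        have h2 := card_le_card h1
        rw [card_erase_of_mem hve, (mem_powersetCard.1 hec).2] at h2
        exact h2
      obtain ⟨B, heB, hBT, hBc⟩ := exists_subsuperset_card_eq
        (subset_compl_iff_disjoint_right.2 sdiff_disjoint : e \ T ⊆ Tᶜ) hle (by omega)
      refine mem_biUnion.2 ⟨B, mem_filter.2 ⟨mem_powersetCard.2 ⟨hBT, hBc⟩, e, he, heB⟩,
        mem_powerset.2 ?_⟩
      intro x hx
      by_cases hxT : x ∈ T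
      · exact mem_union_right _ hxT
      · exact mem_union_left _ (heB (mem_sdiff.2 ⟨hx, hxT⟩))
    · rw [card_powerset]
      refine Nat.pow_le_pow_right (by norm_num) ((card_union_le _ _).trans ?_)
      rw [hT, (mem_powersetCard.1 (mem_filter.1 hB).1).2]
  have hn0 : (0 : ℝ) < n := by exact_mod_cast (by omega : 0 < n)
  have hs : (#(∂ P) : ℝ) * n ≤ 4 * Q * #M := by
    have h1 : q ≤ 2 * #M + #(∂ P) := by omega
    have h2 : #(∂ P) * (n - t - (i + 1)) ≤ Q * (2 * #M + #(∂ P)) :=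
      hq2.trans (Nat.mul_le_mul_left _ h1)
    have h3 : #(∂ P) * n ≤ #(∂ P) * (2 * (n - t - (i + 1) - Q)) :=
      Nat.mul_le_mul_left _ (by omega)
    have h4 : #(∂ P) * (n - t - (i + 1)) =
        #(∂ P) * (n - t - (i + 1) - Q) + #(∂ P) * Q := by
      rw [← mul_add, Nat.sub_add_cancel (by omega)]
    have h5 : #(∂ P) * n ≤ 4 * Q * #M := by
      have h6 : Q * (2 * #M + #(∂ P)) = 2 * Q * #M + #(∂ P) * Q := by ring
      have h7 : #(∂ P) * (2 * (n - t - (i + 1) - Q)) =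
        2 * (#(∂ P) * (n - t - (i + 1) - Q)) := by ring
      have h8 : 4 * Q * #M = 2 * (2 * Q * #M) := by ring
      omega
    exact_mod_cast h5
  have hPs : (#P : ℝ) ≤ 1 / (8 * Q * 2 ^ (i + 1 + t)) * n * #(∂ P) := by
    refine hn₁ n (by omega) P
      (fun B hB => (mem_powersetCard.1 (mem_filter.1 hB).1).2) ?_
    refine le_of_mul_le_mul_right (hs.trans ?_) hn0
    calc 4 * Q * (#M : ℝ) ≤ 4 * Q * (δ / (4 * Q) * n ^ (i + 1)) := by gcongr
      _ = δ * n ^ i * n := by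
        field_simp
        ring
  have hMP' : (#M : ℝ) ≤ #P * 2 ^ (i + 1 + t) := by exact_mod_cast hMP
  have hM0 : (#M : ℝ) ≤ 0 := by
    have h1 : 4 * Q * (#M : ℝ) ≤ 4 * Q *
        (1 / (8 * Q * 2 ^ (i + 1 + t)) * n * #(∂ P) * 2 ^ (i + 1 + t)) := by
      gcongr
      exact hMP'.trans (by gcongr)
    have h2 : 4 * Q * (1 / (8 * Q * 2 ^ (i + 1 + t)) * n * #(∂ P) * 2 ^ (i + 1 + t)) =
        (#(∂ P) : ℝ) * n / 2 := by
      field_simp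
      ring
    have h3 : 0 ≤ 4 * Q * (#M : ℝ) := by positivity
    have h4 : 4 * Q * (#M : ℝ) ≤ 0 := by linarith
    have h5 : (0 : ℝ) < 4 * Q := by positivity
    exact nonpos_of_mul_nonpos_right h4 h5
  have hMe : M = ∅ := by
    rw [← card_eq_zero]
    exact_mod_cast le_antisymm hM0 (by positivity)
  intro e he heT
  by_contra heH
  have : e ∈ M := mem_filter.2 ⟨mem_powersetCard.2 ⟨subset_univ _, he⟩, heT, heH⟩
  rw [hMe] at this
  exact notMem_empty _ this

/-- For `1`-uniform hypergraphs any `t` vertices that are edges form the core. -/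
theorem exists_core_of_one {t : ℕ} (hn : t ≤ n) (hH : EveryCovered (0 + t) 1 H) :
    ∃ T : Finset (Fin n), #T = t ∧
      ∀ e : Finset (Fin n), #e = 0 + 1 → ¬ Disjoint e T → e ∈ H := by
  set Y : Finset (Fin n) := univ.filter fun v => {v} ∈ H
  have hYt : t ≤ #Y := by
    by_contra! h
    obtain ⟨u, hu, hcov⟩ := hH.exists_notMem (by omega) (A := Y) (by omega)
    refine hu (mem_filter.2 ⟨mem_univ _, ?_⟩)
    simpa using hcov ∅ (by simp)
  obtain ⟨T, hTY, hT⟩ := exists_subset_card_eq hYt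
  refine ⟨T, hT, fun e he heT => ?_⟩
  obtain ⟨v, rfl⟩ := card_eq_one.1 he
  rw [disjoint_singleton_left, not_not] at heT
  exact (mem_filter.1 (hTY heT)).2

end

end CoveredSets

theorem theorem1 (k r : ℕ) (hr : 1 ≤ r) (hk : r ≤ k + 1) :
    ∃ n₀ : ℕ, ∀ n : ℕ, n₀ < n →
      CoveredSets.f n k r = CoveredSets.g n k r ∧
      ∀ (V : Type*) [Fintype V] [DecidableEq V] (H : Finset (Finset V)),
        Fintype.card V = n →
        CoveredSets.EveryCovered k r H →
        H.card = CoveredSets.f n k r →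
        ∃ G ∈ CoveredSets.family n k r, CoveredSets.Isomorphic H G := by
  obtain ⟨j, rfl⟩ : ∃ j, r = j + 1 := ⟨r - 1, by omega⟩
  obtain ⟨t, rfl⟩ : ∃ t, k = j + t := ⟨k - j, by omega⟩
  obtain ⟨n₀, hn₀⟩ : ∃ n₀ : ℕ, ∀ n ≥ n₀, ∀ H : Finset (Finset (Fin n)),
      CoveredSets.EveryCovered (j + t) (j + 1) H → H.card ≤ CoveredSets.g n (j + t) (j + 1) →
      ∃ T : Finset (Fin n), T.card = t ∧
        ∀ e : Finset (Fin n), e.card = j + 1 → ¬ Disjoint e T → e ∈ H := by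
    cases j with
    | zero => exact ⟨t, fun n hn H hH _ => CoveredSets.exists_core_of_one hn hH⟩
    | succ i => exact CoveredSets.exists_core i t
  refine ⟨n₀ + (j + t), fun n hn => ?_⟩
  have hle : CoveredSets.f n (j + t) (j + 1) ≤ CoveredSets.g n (j + t) (j + 1) :=
    CoveredSets.f_le_g (by omega)
  constructor
  · obtain ⟨H, hH, hHf⟩ := (CoveredSets.f_isLeast hr (show j + t < n by omega)).1
    obtain ⟨T, hT, hfull⟩ := hn₀ n (by omega) H hH (by omega)
    have := (hH.conclusion hT hfull (by omega)).1
    omega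
  · intro V _ _ H hV hH hHf
    have σ : V ≃ Fin n := Fintype.equivFinOfCardEq hV
    have hc : (H.image fun e => e.map σ.toEmbedding).card = H.card :=
      Finset.card_image_of_injective _ (Finset.map_injective _)
    obtain ⟨T, hT, hfull⟩ := hn₀ n (by omega) _ (hH.image_map σ) (by omega)
    obtain ⟨G, hG, hiso⟩ := ((hH.image_map σ).conclusion hT hfull (by omega)).2
    exact ⟨G, hG, CoveredSets.Isomorphic.trans ⟨σ, rfl⟩ hiso⟩
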